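/- **Setting.** Let $G=(V,E)$ be a finite acyclic directed multigraph (a single source multicast network with unit-capacity channels), with one source $s$ having no incoming channels, a set $T$ of sinks having no outgoing channels ($s\notin T$), and internal nodes $J=V\setminus(\{s\}\cup T)$. Let $\mathcal F$ be a finite field and let the information rate be an integer $w\ge 1$ with $w\le\min_{t\in T}C_t$, where $C_t$ is the minimum cut capacity between $s$ and $t$. Put $\delta_t=C_t-w$. The source has $w$ imaginary incoming channels, $In(s)=\{d_1',\dots,d_w'\}$. A linear network code over $\mathcal F$ is a choice of coefficients $k_{d,e}\in\mathcal F$ for all $e\in E$, $d\in In(\mathrm{tail}(e))$. Its extended global encoding kernels are the vectors $\tilde f_e\in\mathcal F^{In(s)\cup E}$ given by $\tilde f_{d_i'}=1_{d_i'}$ and $\tilde f_e=\sum_{d\in In(\mathrm{tail}(e))}k_{d,e}\tilde f_d+1_e$ for $e\in E$, where $1_x$ is the unit vector at $x$. Let $\tilde F_t=(\tilde f_e)_{e\in In(t)}$. The message space is $\Phi(t)=\{(X,0)\tilde F_t: X\in\mathcal F^w\}$, and for an error pattern $\rho\subseteq E$ the error space is $\Delta(t,\rho)=\{(0,Z)\tilde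 F_t: Z\in\mathcal F^E,\ Z_e=0 \text{ for } e\notin\rho\}$. Write $\rho\prec_t\rho'$ if $\Delta(t,\rho)\subseteq\Delta(t,\rho')$ for every linear network code, and let $\mathrm{rank}_t(\rho)=\min\{|\rho'|:\rho\prec_t\rho'\}$. For an integer $b$ let $R_t(b)=\{\rho\subseteq E: |\rho|=\mathrm{rank}_t(\rho)=b\}$ (so $R_t(b)=\emptyset$ for $b<0$). A random linear network error correction code is one whose coefficients $k_{d,e}$ are independent and uniformly distributed on $\mathcal F$. Let $D_{\min}^{(t)}$ be its minimum distance at $t$, that is $D_{\min}^{(t)}=\min\{\mathrm{rank}_t(\rho):\dim(\Delta(t,\rho)\cap\Phi(t))>0\}$ if $\dim\Phi(t)=w$, and $D_{\min}^{(t)}=0$ if $\dim\Phi(t)<w$. **Statement.** For every integer $d\ge 0$ and every $t\in T$, $$\Pr\bigl(D_{\min}^{(t)}<\delta_t+1-d\bigr)\le\frac{|R_t(\delta_t-d)|\binom{d+|J|+1}{|J|}}{(|\mathcal F|-1)^{d+1}},$$ and $$\Pr\bigl(D_{\min}^{(t)}\ge\delta_t+1-d\ \text{ for all } t\in T\bigr)\ge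 1-\sum_{t\in T}\frac{|R_t(\delta_t-d)|\binom{d+|J|+1}{|J|}}{(|\mathcal F|-1)^{d+1}}.$$ The first bound refines the bound of Balli, Yan and Zhang, which has $\binom{|E|}{\delta_t-d}$ in place of $|R_t(\delta_t-d)|$: for all $t\in T$ and $0\le d\le\delta_t$, $|R_t(\delta_t-d)|\le\binom{|E|}{\delta_t-d}$. -/

import Mathlib

open MeasureTheory ProbabilityTheory

namespace NEC

/-- A single-source multicast network: a directed multigraph with node set `V` and channel set `E`
(every channel has unit capacity), without directed cycles, with one source node that has no
incoming channels and a set of sink nodes that have no outgoing channels. Finiteness is assumed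
through `[Fintype V] [Fintype E]` where it is needed. -/
structure Network (V E : Type*) where
  tail : E → V
  head : E → V
  source : V
  sinks : Finset V
  source_notMem_sinks : source ∉ sinks
  acyclic : ∀ v : V, ¬ Relation.TransGen (fun a b => ∃ e, tail e = a ∧ head e = b) v v
  no_in_source : ∀ e, head e ≠ source
  no_out_sink : ∀ e, tail e ∉ sinks

namespace Network

variable {V E : Type*} (N : Network V E)

open Classical in
/-- The set `J = V \ ({s} ∪ T)` of internal nodes. -/
noncomputable def internalNodes [Fintype V] : Finset V :=
  Finset.univ.filter fun v => v ≠ N.source ∧ v ∉ N.sinks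

/-- The set of channels `A` is a cut between `a` and `b`: after its removal no directed path leads
from `a` to `b`. -/
def IsCut (a b : V) (A : Finset E) : Prop :=
  ¬ Relation.ReflTransGen (fun u v => ∃ e, e ∉ A ∧ N.tail e = u ∧ N.head e = v) a b

/-- The minimum cut capacity `C_t` between the source and the node `t`. -/
noncomputable def minCut (t : V) : ℕ :=
  sInf {n | ∃ A : Finset E, N.IsCut N.source t A ∧ A.card = n}

/-- The redundancy `δ_t = C_t - w` of a sink node `t`, as an integer. -/
noncomputable def redundancy (w : ℕ) (t : V) : ℤ := (N.minCut t : ℤ) - (w : ℤ)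

/-- The channel `d` enters the node at which the channel `e` starts. Here `d` is one of the `w`
imaginary message channels, which enter the source (`Sum.inl`), or a real channel (`Sum.inr`). -/
def Feeds {w : ℕ} : Fin w ⊕ E → E → Prop
  | Sum.inl _, e => N.tail e = N.source
  | Sum.inr d, e => N.head d = N.tail e

/-- The adjacent pairs of channels `(d, e)`, i.e. `d ∈ In(tail e)`. -/
abbrev Pair (w : ℕ) : Type _ := {p : (Fin w ⊕ E) × E // N.Feeds p.1 p.2}

/-- A linear network code of rate `w` over `F`: a local encoding coefficient `k_{d,e}` for each
adjacent pair of channels. -/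
abbrev Code (w : ℕ) (F : Type*) : Type _ := N.Pair w → F

/-- In a finite acyclic network the relation "`d` enters the tail of `e`" is well founded. -/
theorem wf_channels [Finite E] : WellFounded fun d e : E => N.head d = N.tail e := by
  have key : ∀ d e : E, Relation.TransGen (fun d e : E => N.head d = N.tail e) d e →
      Relation.TransGen (fun a b => ∃ e, N.tail e = a ∧ N.head e = b) (N.tail d) (N.tail e) := by
    intro d e h
    induction h with
    | single h => exact Relation.TransGen.single ⟨d, rfl, h⟩
    | tail _ h ih => exact ih.tail ⟨_, rfl, h⟩
  have : Std.Irrefl (Relation.TransGen fun d e : E => N.head d = N.tail e) :=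
    ⟨fun e he => N.acyclic _ (key e e he)⟩
  have wf : WellFounded (Relation.TransGen fun d e : E => N.head d = N.tail e) :=
    Finite.wellFounded_of_trans_of_irrefl _
  exact Subrelation.wf (r := Relation.TransGen fun d e : E => N.head d = N.tail e)
    (fun {_ _} h => Relation.TransGen.single h) wf

section Code

variable [Fintype E] {F : Type*} [Field F] {w : ℕ}

open Classical in
/-- The extended global encoding kernel of a real channel, a vector with coordinates in
`In(s) ∪ E`, defined recursively by `f_e = ∑_{d ∈ In(tail e)} k_{d,e} f_d + 1_e`, where
`f_d = 1_d` for each imaginary message channel `d`. -/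
noncomputable def extKernel (c : N.Code w F) : E → (Fin w ⊕ E → F) :=
  N.wf_channels.fix fun e f =>
    (∑ i : Fin w, if h : N.tail e = N.source
        then c ⟨(Sum.inl i, e), h⟩ • Pi.single (Sum.inl i) (1 : F) else 0)
    + (∑ d : E, if h : N.head d = N.tail e then c ⟨(Sum.inr d, e), h⟩ • f d h else 0)
    + Pi.single (Sum.inr e) (1 : F)

open Classical in
theorem extKernel_eq (c : N.Code w F) (e : E) :
    N.extKernel c e =
      (∑ i : Fin w, if h : N.tail e = N.source
          then c ⟨(Sum.inl i, e), h⟩ • Pi.single (Sum.inl i) (1 : F) else 0)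
      + (∑ d : E, if h : N.head d = N.tail e
          then c ⟨(Sum.inr d, e), h⟩ • N.extKernel c d else 0)
      + Pi.single (Sum.inr e) (1 : F) := by
  unfold extKernel
  rw [WellFounded.fix_eq]

/-- The set `In(t)` of incoming channels of `t`. -/
abbrev InCh (t : V) : Type _ := {e : E // N.head e = t}

/-- The decoding matrix at `t`, whose columns are the extended global encoding kernels of the
incoming channels of `t`. -/
noncomputable def decodingMatrix (c : N.Code w F) (t : V) : Matrix (Fin w ⊕ E) (N.InCh t) F :=
  Matrix.of fun d e => N.extKernel c e.1 d

/-- The error space `Δ(t,ρ)`: all `(0, Z) F_t` where the error message vector `Z` matches the error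
pattern `ρ`, i.e. vanishes off `ρ`. -/
noncomputable def errorSpace (c : N.Code w F) (t : V) (ρ : Finset E) :
    Submodule F (N.InCh t → F) where
  carrier := {v | ∃ Z : E → F, (∀ e, e ∉ ρ → Z e = 0) ∧
    v = Matrix.vecMul (Sum.elim (0 : Fin w → F) Z) (N.decodingMatrix c t)}
  zero_mem' := ⟨0, fun _ _ => rfl, by simp⟩
  add_mem' := by
    rintro _ _ ⟨Z, hZ, rfl⟩ ⟨Z', hZ', rfl⟩
    refine ⟨Z + Z', fun e he => by simp [hZ e he, hZ' e he], ?_⟩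
    rw [← Matrix.add_vecMul, ← Sum.elim_add_add, add_zero]
  smul_mem' := by
    rintro a _ ⟨Z, hZ, rfl⟩
    refine ⟨a • Z, fun e he => by simp [hZ e he], ?_⟩
    rw [← Matrix.smul_vecMul]
    congr 1
    ext (i | e) <;> simp

/-- The message space `Φ(t)`: all `(X, 0) F_t` with `X` a message vector. -/
noncomputable def messageSpace (c : N.Code w F) (t : V) : Submodule F (N.InCh t → F) where
  carrier := {v | ∃ X : Fin w → F,
    v = Matrix.vecMul (Sum.elim X (0 : E → F)) (N.decodingMatrix c t)}
  zero_mem' := ⟨0, by simp⟩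
  add_mem' := by
    rintro _ _ ⟨X, rfl⟩ ⟨X', rfl⟩
    refine ⟨X + X', ?_⟩
    rw [← Matrix.add_vecMul, ← Sum.elim_add_add, add_zero]
  smul_mem' := by
    rintro a _ ⟨X, rfl⟩
    refine ⟨a • X, ?_⟩
    rw [← Matrix.smul_vecMul]
    congr 1
    ext (i | e) <;> simp

variable (F w) in
/-- The error pattern `ρ₁` is dominated by `ρ₂` with respect to `t`: the error space of `ρ₁` is
contained in that of `ρ₂` for every linear network code. -/
def Dominated (t : V) (ρ₁ ρ₂ : Finset E) : Prop :=
  ∀ c : N.Code w F, N.errorSpace c t ρ₁ ≤ N.errorSpace c t ρ₂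

variable (F w) in
/-- The rank of an error pattern with respect to `t`. -/
noncomputable def patternRank (t : V) (ρ : Finset E) : ℕ :=
  sInf {n | ∃ ρ' : Finset E, N.Dominated F w t ρ ρ' ∧ ρ'.card = n}

variable (F w) in
open Classical in
/-- The set `R_t(b)` of error patterns `ρ` with `|ρ| = rank_t(ρ) = b` (empty when `b < 0`). -/
noncomputable def patternsOfRank (t : V) (b : ℤ) : Finset (Finset E) :=
  Finset.univ.filter fun ρ => (ρ.card : ℤ) = b ∧ (N.patternRank F w t ρ : ℤ) = b

open Classical in
/-- The minimum distance of the code at `t`: the least rank of an error pattern whose error space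
meets the message space non-trivially; it is `0` when messages cannot be decoded at `t` even without
errors, that is when `dim Φ(t) < w`. -/
noncomputable def minDist (c : N.Code w F) (t : V) : ℕ :=
  if Module.finrank F (N.messageSpace c t) < w then 0
  else sInf {r | ∃ ρ : Finset E,
    0 < Module.finrank F ↥(N.errorSpace c t ρ ⊓ N.messageSpace c t) ∧
      N.patternRank F w t ρ = r}

end Code

/-- `K` is a random linear network code on the probability space `(Ω, μ)`: the local encoding
coefficients are independent random variables, each uniformly distributed on the field `F`. -/
structure IsRandomCode {Ω : Type*} [MeasurableSpace Ω] (μ : Measure Ω) {F : Type*} [Fintype F]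
    [MeasurableSpace F] {w : ℕ} (K : Ω → N.Code w F) : Prop where
  measurable : ∀ p : N.Pair w, Measurable fun ω => K ω p
  indep : iIndepFun (fun (p : N.Pair w) (ω : Ω) => K ω p) μ
  uniform : ∀ (p : N.Pair w) (a : F), μ.real {ω | K ω p = a} = 1 / (Fintype.card F : ℝ)

end Network

end NEC

/-! Fix a sink `t` and write q = |F|. A set of channels is linked to `t` if it cannot be separated
from `t` by fewer channels than it has. The size of a boundary is submodular, so linked sets can be
augmented as in Menger's theorem (`Linked.exists_extension`), and the patterns with |ρ| = rank_t(ρ)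
are exactly the linked ones (`linked_of_patternRank_eq_card`, `Linked.patternRank_eq_card`). If the
minimum distance is at most b = δ_t - d, some linked ρ of size b confuses a non-zero message with an
error (`exists_confusable_of_minDist_le`). A union bound over R_t(b) leaves a single ρ to treat.

Extend ρ by channels leaving the source to a linked set B of size C_t, and push B through the
internal nodes in topological order. At each node the channels of the current set that enter it are
exchanged for equally many that leave it. The coefficients between the two groups form a uniform
square matrix, and the rank lost is at most the corank of a translate of it, which is at least x
with probability at most (q-1)^(-x) (`ncard_rank_add_le`). Hence a total loss of k has probability
at most (q-1)^(-k) times the number of ways to distribute k over |J| nodes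
(`Linked.rank_distribution`). If j dimensions are lost, at least d - j remain beyond |ρ| + w, and
random source coefficients confuse a message with probability at most (q-1)^(-(d-j+1))
(`ncard_exists_mem_mul_pow_le`). So the source acts as one more node: a loss of d + 1 is distributed
over |J| + 1 nodes, which gives the binomial coefficient.

Probabilities are treated as numbers of codes; conditioning on the other coefficients becomes
averaging over translations of the space of codes (`ncard_inter_mul_le`). -/

namespace NEC

/-! ### Double counting and accumulation of losses -/

/-- If `A` is invariant under the translations `φ m` and from every point of `A` at most a fraction
`1 / p` of these translations lead into `B`, then `B` fills at most a fraction `1 / p` of `A`. -/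
theorem ncard_inter_mul_le {G M : Type*} [AddGroup G] [Finite G] [Finite M] [Nonempty M]
    (φ : M → G) (A B : Set G) (hA : ∀ c m, c + φ m ∈ A ↔ c ∈ A) (p : ℕ)
    (hB : ∀ c ∈ A, {m | c + φ m ∈ B}.ncard * p ≤ Nat.card M) :
    (A ∩ B).ncard * p ≤ A.ncard := by
  classical
  have := Fintype.ofFinite G
  have := Fintype.ofFinite M
  have hpos : 0 < Nat.card M := Nat.card_pos
  refine Nat.le_of_mul_le_mul_left ?_ hpos
  -- Translation by `φ m` permutes the group and preserves `A`; so every `m` gives the same count,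
  -- and the pairs `(c, m)` can be counted in either order.
  have h1 : ∀ m : M, (A ∩ B).ncard = ∑ c : G, if c ∈ A ∧ c + φ m ∈ B then 1 else 0 := by
    intro m
    rw [← Equiv.sum_comp (Equiv.addRight (-φ m))]
    rw [Set.ncard_eq_toFinset_card', Finset.card_eq_sum_ones, ← Finset.sum_filter]
    refine Finset.sum_congr ?_ fun _ _ => rfl
    ext c
    have := hA (c + -φ m) m
    simp only [neg_add_cancel_right] at this
    simp [this]
  have h2 : Nat.card M * (A ∩ B).ncard =
      ∑ c : G, if c ∈ A then {m | c + φ m ∈ B}.ncard else 0 := by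
    have : Nat.card M * (A ∩ B).ncard = ∑ m : M, (A ∩ B).ncard := by
      simp [Nat.card_eq_fintype_card]
    rw [this, Finset.sum_congr rfl fun m _ => h1 m, Finset.sum_comm]
    refine Finset.sum_congr rfl fun c _ => ?_
    by_cases hc : c ∈ A
    · simp [hc, Set.ncard_eq_toFinset_card']
    · simp [hc]
  have h3 : A.ncard = ∑ c : G, if c ∈ A then 1 else 0 := by
    rw [Set.ncard_eq_toFinset_card', Finset.card_eq_sum_ones, ← Finset.sum_filter]
    exact Finset.sum_congr (by ext; simp) fun _ _ => rfl
  rw [← mul_assoc, h2, h3, Finset.sum_mul, Finset.mul_sum]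
  refine Finset.sum_le_sum fun c _ => ?_
  by_cases hc : c ∈ A
  · simpa [hc] using hB c hc
  · simp [hc]

theorem sum_range_multichoose (n k : ℕ) :
    ∑ j ∈ Finset.range (k + 1), n.multichoose j = (n + 1).multichoose k := by
  induction k with
  | zero => simp
  | succ k ih => rw [Finset.sum_range_succ, ih, Nat.multichoose_succ_succ, add_comm]

/-- Accumulation of losses: if a loss of at least `k` before the current step has weight at most
`m.multichoose k`, and a further loss multiplies the weight accordingly, then the weight of a total
loss of `k` is at most `(m + 1).multichoose k`. -/
theorem ncard_mul_pow_le_of_conditional {Ω : Type*} [Finite Ω] (a : Ω → ℕ) (C r m Q k : ℕ)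
    (haC : ∀ c, a c ≤ C)
    (ha : ∀ j, {c | a c + j ≤ C}.ncard * r ^ j ≤ m.multichoose j * Q) (B : Set Ω)
    (hB : ∀ j < k, ({c | a c + j = C} ∩ B).ncard * r ^ (k - j) ≤ {c | a c + j = C}.ncard) :
    B.ncard * r ^ k ≤ (m + 1).multichoose k * Q := by
  classical
  -- Split by the earlier loss `C - a c`: either it is some `j < k`, and the present step must
  -- account for the other `k - j`, or it already reaches `k`.
  have hsub : B ⊆ (⋃ j ∈ Finset.range k, ({c | a c + j = C} ∩ B)) ∪ {c | a c + k ≤ C} := by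
    intro c hc
    by_cases h : a c + k ≤ C
    · exact Or.inr h
    · refine Or.inl ?_
      simp only [Set.mem_iUnion, Finset.mem_range]
      have := haC c
      exact ⟨C - a c, by omega, by simp; omega, hc⟩
  have h1 : B.ncard ≤ ∑ j ∈ Finset.range k, ({c | a c + j = C} ∩ B).ncard
      + {c | a c + k ≤ C}.ncard :=
    (Set.ncard_le_ncard hsub (Set.toFinite _)).trans <| (Set.ncard_union_le _ _).trans <|
      Nat.add_le_add_right (Finset.set_ncard_biUnion_le _ _) _
  calc B.ncard * r ^ k
      ≤ (∑ j ∈ Finset.range k, ({c | a c + j = C} ∩ B).ncard + {c | a c + k ≤ C}.ncard) * r ^ k :=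
        Nat.mul_le_mul_right _ h1
    _ = ∑ j ∈ Finset.range k, ({c | a c + j = C} ∩ B).ncard * r ^ k
        + {c | a c + k ≤ C}.ncard * r ^ k := by rw [add_mul, Finset.sum_mul]
    _ ≤ ∑ j ∈ Finset.range k, m.multichoose j * Q + m.multichoose k * Q := by
        refine Nat.add_le_add (Finset.sum_le_sum fun j hj => ?_) (ha k)
        have hj' : j < k := Finset.mem_range.1 hj
        calc ({c | a c + j = C} ∩ B).ncard * r ^ k
            = ({c | a c + j = C} ∩ B).ncard * r ^ (k - j) * r ^ j := by
              rw [mul_assoc, ← pow_add, Nat.sub_add_cancel hj'.le]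
          _ ≤ {c | a c + j = C}.ncard * r ^ j := Nat.mul_le_mul_right _ (hB j hj')
          _ ≤ {c | a c + j ≤ C}.ncard * r ^ j := Nat.mul_le_mul_right _
              (Set.ncard_le_ncard (fun c hc => le_of_eq hc) (Set.toFinite _))
          _ ≤ m.multichoose j * Q := ha j
    _ = (m + 1).multichoose k * Q := by
        rw [← Finset.sum_mul, ← add_mul, ← Finset.sum_range_succ, sum_range_multichoose]

/-! ### Rank loss of random matrices over a finite field -/

section LinearAlgebra

variable {F : Type*} [Field F]

open Module in
/-- The fibres of a linear map of rank at least `r` between finite spaces are small. -/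
theorem ncard_fiber_mul_pow_le [Finite F] {V W : Type*} [AddCommGroup V] [Module F V] [Finite V]
    [AddCommGroup W] [Module F W] (f : V →ₗ[F] W) (z : W) (r : ℕ)
    (hr : r ≤ finrank F (LinearMap.range f)) :
    {v | f v = z}.ncard * Nat.card F ^ r ≤ Nat.card V := by
  classical
  have : FiniteDimensional F V := Module.Finite.of_finite
  have hle : {v | f v = z}.ncard ≤ Nat.card (LinearMap.ker f) := by
    by_cases h : ∃ v₀, f v₀ = z
    · obtain ⟨v₀, rfl⟩ := h
      rw [← Nat.card_coe_set_eq]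
      refine Nat.card_le_card_of_injective
        (fun v : {v | f v = f v₀} => (⟨v.1 - v₀, by
          have := v.2; simp only [Set.mem_ofPred_eq] at this; simp [this]⟩ : LinearMap.ker f)) ?_
      intro v v' hv
      have := congrArg Subtype.val hv
      exact Subtype.ext (sub_left_injective this)
    · have : {v | f v = z} = ∅ := by
        ext v; simp only [Set.mem_ofPred_eq, Set.mem_empty_iff_false, iff_false]
        exact fun hv => h ⟨v, hv⟩
      simp [this]
  have hrank := LinearMap.finrank_range_add_finrank_ker f
  have hF : 0 < Nat.card F := Nat.card_pos
  calc {v | f v = z}.ncard * Nat.card F ^ r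
      ≤ Nat.card (LinearMap.ker f) * Nat.card F ^ finrank F (LinearMap.range f) :=
        Nat.mul_le_mul hle (Nat.pow_le_pow_right hF hr)
    _ = Nat.card V := by
        rw [Module.natCard_eq_pow_finrank (K := F) (V := LinearMap.ker f),
          Module.natCard_eq_pow_finrank (K := F) (V := V), ← pow_add, ← hrank, add_comm]

open Module in
/-- A space of dimension at least `x` over `F` has at least `(|F| - 1) ^ x` independent families
of `x` vectors. -/
theorem pow_le_ncard_linearIndependent [Fintype F] {V : Type*} [AddCommGroup V] [Module F V]
    [Finite V] (x : ℕ) (hx : x ≤ finrank F V) :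
    (Fintype.card F - 1) ^ x ≤ Nat.card {s : Fin x → V // LinearIndependent F s} := by
  have := Fintype.ofFinite V
  rw [card_linearIndependent hx, ← Fin.prod_const]
  refine Finset.prod_le_prod' fun i _ => ?_
  have hq : 1 ≤ Fintype.card F := Fintype.card_pos
  -- With n the dimension, the `i`-th factor of the count is q^n - q^i ≥ q^i (q - 1) ≥ q - 1,
  -- because i < n.
  have h1 : Fintype.card F ^ (i : ℕ) * Fintype.card F ≤ Fintype.card F ^ finrank F V := by
    rw [← pow_succ]; exact Nat.pow_le_pow_right hq (by omega)
  have h2 : Fintype.card F - 1 ≤ Fintype.card F ^ (i : ℕ) * (Fintype.card F - 1) :=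
    Nat.le_mul_of_pos_left _ (by positivity)
  rw [Nat.mul_sub, mul_one] at h2
  omega

open Module in
/-- A uniformly random square matrix has corank at least `x` with probability at most
`1 / (|F| - 1) ^ x`. -/
theorem ncard_rank_add_le [Fintype F] {α β : Type*} [Fintype α] [Fintype β]
    (hαβ : Fintype.card α = Fintype.card β) (x : ℕ) :
    {K : Matrix α β F | K.rank + x ≤ Fintype.card β}.ncard * (Fintype.card F - 1) ^ x ≤
      Nat.card (Matrix α β F) := by
  classical
  -- Double count the pairs of a matrix and an independent `x`-family in its kernel. A bad matrix
  -- occurs in at least (q-1)^x pairs, and a fixed family is killed by at most a fraction q^(-|α|x)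
  -- of all matrices.
  let T := {s : Fin x → β → F // LinearIndependent F s}
  let r : Matrix α β F → T → Prop := fun K s => ∀ i, K.mulVec (s.1 i) = 0
  have : Finite (Matrix α β F) := inferInstanceAs (Finite (α → β → F))
  have := Fintype.ofFinite (Matrix α β F)
  have := Fintype.ofFinite T
  have hlow : ∀ K : Matrix α β F, K.rank + x ≤ Fintype.card β →
      (Fintype.card F - 1) ^ x ≤ (Finset.univ.filter fun s => r K s).card := by
    intro K hK
    have hker : x ≤ finrank F (LinearMap.ker K.mulVecLin) := by
      have := LinearMap.finrank_range_add_finrank_ker K.mulVecLin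
      rw [finrank_fintype_fun_eq_card] at this
      unfold Matrix.rank at hK
      omega
    refine (pow_le_ncard_linearIndependent x hker).trans ?_
    rw [← Fintype.card_subtype, ← Nat.card_eq_fintype_card]
    refine Nat.card_le_card_of_injective
      (fun s => ⟨⟨fun i => (s.1 i : β → F), s.2.map' (LinearMap.ker K.mulVecLin).subtype
        (Submodule.ker_subtype _)⟩, fun i => (s.1 i).2⟩) ?_
    intro s s' h
    have h' := congrArg (fun u => u.1.1) h
    refine Subtype.ext (funext fun i => Subtype.ext (congrFun h' i))
  have hup : ∀ s : T, (Finset.univ.filter fun K => r K s).card *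
      Nat.card F ^ (Fintype.card α * x) ≤ Nat.card (Matrix α β F) := by
    intro s
    let f : Matrix α β F →ₗ[F] (Fin x → α → F) :=
      LinearMap.pi fun i => { toFun := fun K => K.mulVec (s.1 i)
                              map_add' := fun K L => Matrix.add_mulVec K L _
                              map_smul' := fun a K => Matrix.smul_mulVec a K _ }
    have hsurj : Function.Surjective f := by
      intro y
      obtain ⟨g, hg⟩ := (Fintype.linearCombination F s.1).exists_leftInverse_of_injective
        (by
          rw [LinearMap.ker_eq_bot']
          intro m hm
          have := (Fintype.linearIndependent_iff.1 s.2) m (by simpa [Fintype.linearCombination_apply] using hm)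
          exact funext this)
      refine ⟨LinearMap.toMatrix' (Fintype.linearCombination F y ∘ₗ g), ?_⟩
      funext i
      change (LinearMap.toMatrix' (Fintype.linearCombination F y ∘ₗ g)).mulVec (s.1 i) = y i
      rw [LinearMap.toMatrix'_mulVec]
      have h1 : g (s.1 i) = Pi.single i 1 := by
        have := LinearMap.congr_fun hg (Pi.single i 1)
        simpa using this
      simp [h1]
    have := ncard_fiber_mul_pow_le f 0 (Fintype.card α * x) (by
      rw [LinearMap.range_eq_top.2 hsurj, finrank_top]
      simp [finrank_pi_fintype, mul_comm])
    refine le_trans (le_of_eq ?_) this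
    congr 1
    rw [Set.ncard_eq_toFinset_card']
    congr 1
    ext K
    simp [r, f, funext_iff]
  have hcount := Finset.sum_card_bipartiteAbove_eq_sum_card_bipartiteBelow (s := Finset.univ)
    (t := Finset.univ) r
  have hF : 0 < Nat.card F := Nat.card_pos
  -- Squareness enters here: there are at most q^(|β|x) = q^(|α|x) families, which cancels the
  -- fraction above.
  have hTle : Fintype.card T ≤ Nat.card F ^ (Fintype.card α * x) := by
    rw [← Nat.card_eq_fintype_card]
    refine (Nat.card_le_card_of_injective (Subtype.val : T → _) Subtype.val_injective).trans ?_
    simp [Nat.card_eq_fintype_card, hαβ, ← pow_mul]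
  have hbad : {K : Matrix α β F | K.rank + x ≤ Fintype.card β}.ncard * (Fintype.card F - 1) ^ x ≤
      ∑ K : Matrix α β F, (Finset.univ.filter fun s => r K s).card := by
    rw [Set.ncard_eq_toFinset_card', ← smul_eq_mul]
    refine (Finset.card_nsmul_le_sum _ _ _ fun K hK => hlow K (by simpa using hK)).trans ?_
    exact Finset.sum_le_sum_of_subset (Finset.subset_univ _)
  have hpow : 0 < Nat.card F ^ (Fintype.card α * x) := by positivity
  refine Nat.le_of_mul_le_mul_right (hbad.trans_eq hcount |> Nat.mul_le_mul_right _ |>.trans ?_) hpow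
  rw [Finset.sum_mul]
  refine (Finset.sum_le_sum fun s _ => hup s).trans ?_
  rw [Finset.sum_const, smul_eq_mul, Finset.card_univ, mul_comm]
  exact Nat.mul_le_mul_left _ hTle

open Module Submodule in
theorem finrank_sup_eq_add_finrank_map_mkQ {V : Type*} [AddCommGroup V] [Module F V]
    [FiniteDimensional F V] (U W : Submodule F V) :
    finrank F ↥(U ⊔ W) = finrank F U + finrank F (W.map U.mkQ) := by
  have h2 := LinearMap.finrank_range_add_finrank_ker (U.mkQ.domRestrict (U ⊔ W))
  rw [LinearMap.range_domRestrict, LinearMap.ker_domRestrict, Submodule.ker_mkQ] at h2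
  have h3 : (U ⊔ W).map U.mkQ = W.map U.mkQ := by
    rw [Submodule.map_sup]; simp
  have h4 : finrank F (U.submoduleOf (U ⊔ W)) = finrank F U :=
    (Submodule.submoduleOfEquivOfLe le_sup_left).finrank_eq
  rw [h3] at h2
  change _ + finrank F (U.submoduleOf (U ⊔ W)) = _ at h2
  omega

open Module Submodule in
/-- Replacing the vectors `g` by shifted combinations of them, with coefficient matrix `K`, loses
at most the corank of a translate of `K` from the dimension of the span. -/
theorem exists_finrank_sup_span_le {V : Type*} [AddCommGroup V] [Module F V]
    [FiniteDimensional F V] {α β : Type*} [Fintype α] [Fintype β] (U : Submodule F V)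
    (g : β → V) (s : α → V) :
    ∃ C : Matrix α β F, ∀ K : Matrix α β F,
      finrank F ↥(U ⊔ span F (Set.range g)) + (K + C).rank ≤
        finrank F ↥(U ⊔ span F (Set.range fun d => s d + ∑ e, K d e • g e)) + Fintype.card β := by
  classical
  let G : (β → F) →ₗ[F] V ⧸ U := U.mkQ ∘ₗ Fintype.linearCombination F g
  -- A projection `p` onto the span of `g` modulo `U` cannot increase dimensions, and it turns each
  -- shift `s d` into a combination of `g`. The coefficients of these combinations are the rows of
  -- `C`.
  obtain ⟨p, hp⟩ := (LinearMap.range G).subtype.exists_leftInverse_of_injective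
    (Submodule.ker_subtype _)
  have hC : ∀ d, ∃ y : β → F, G y = p (U.mkQ (s d)) := fun d => (p (U.mkQ (s d))).2
  choose C hC using hC
  refine ⟨Matrix.of C, fun K => ?_⟩
  rw [finrank_sup_eq_add_finrank_map_mkQ, finrank_sup_eq_add_finrank_map_mkQ]
  have hg : (span F (Set.range g)).map U.mkQ = LinearMap.range G := by
    rw [LinearMap.range_comp, Fintype.range_linearCombination]
  let R : Submodule F (β → F) := span F (Set.range (K + Matrix.of C).row)
  have hrank : (K + Matrix.of C).rank = finrank F R := Matrix.rank_eq_finrank_span_row _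
  have hmap : (((span F (Set.range fun d => s d + ∑ e, K d e • g e)).map U.mkQ).map p).map
      (LinearMap.range G).subtype = R.map G := by
    rw [Submodule.map_span, Submodule.map_span, Submodule.map_span, Submodule.map_span]
    congr 1
    rw [← Set.range_comp, ← Set.range_comp, ← Set.range_comp, ← Set.range_comp]
    congr 1
    funext d
    have h1 : U.mkQ (∑ e, K d e • g e) = G (K d) := by
      simp [G, Fintype.linearCombination_apply]
    have h2 : ((p (G (K d)) : LinearMap.range G) : V ⧸ U) = G (K d) := by
      have := LinearMap.congr_fun hp ⟨G (K d), LinearMap.mem_range_self _ _⟩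
      exact congrArg Subtype.val this
    have h3 : (K + Matrix.of C).row d = K d + C d := rfl
    simp only [Function.comp_apply, map_add, h1, h3, Submodule.subtype_apply, h2,
      hC]
    rw [add_comm]
  have hle : finrank F (R.map G) ≤
      finrank F ((span F (Set.range fun d => s d + ∑ e, K d e • g e)).map U.mkQ) := by
    rw [← hmap]
    exact (Submodule.finrank_map_le _ _).trans (Submodule.finrank_map_le _ _)
  -- Applying `G` to the row space of `K + C` loses at most the dimension of `ker G`, which is |β|
  -- minus the dimension spanned by `g` modulo `U`.
  have hR : finrank F R ≤ finrank F (R.map G) + finrank F (LinearMap.ker G) := by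
    have h2 := LinearMap.finrank_range_add_finrank_ker (G.domRestrict R)
    rw [LinearMap.range_domRestrict, LinearMap.ker_domRestrict] at h2
    have h3 : finrank F ((LinearMap.ker G).submoduleOf R) ≤ finrank F (LinearMap.ker G) := by
      refine LinearMap.finrank_le_finrank_of_injective
        (f := ((R.subtype.domRestrict _).codRestrict (LinearMap.ker G) fun v => v.2)) ?_
      intro a b h
      have h' := congrArg Subtype.val h
      exact Subtype.ext (Subtype.ext h')
    change _ + finrank F ((LinearMap.ker G).submoduleOf R) = _ at h2
    omega
  have hGk := LinearMap.finrank_range_add_finrank_ker G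
  rw [finrank_fintype_fun_eq_card] at hGk
  rw [hg, hrank]
  omega

open Module Submodule in
/-- If the vectors `g` contribute at least `w + r` dimensions modulo `D`, then for a random `M` the
map `X ↦ y X + X M g` is non-injective modulo `D` with probability at most
`1 / (|F| - 1) ^ (r + 1)`. -/
theorem ncard_exists_mem_mul_pow_le [Fintype F] {V : Type*} [AddCommGroup V] [Module F V]
    [FiniteDimensional F V] {ι σ : Type*} [Fintype ι] [Fintype σ] (D : Submodule F V)
    (g : σ → V) (y : (ι → F) →ₗ[F] V) (r : ℕ)
    (hr : finrank F D + Fintype.card ι + r ≤ finrank F ↥(D ⊔ span F (Set.range g))) :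
    {M : ι → σ → F | ∃ X ≠ 0, y X + ∑ a, (∑ i, X i * M i a) • g a ∈ D}.ncard *
      (Fintype.card F - 1) ^ (r + 1) ≤ Nat.card (ι → σ → F) := by
  classical
  -- Double count the pairs `(M, X)`. A bad `M` is hit by all q - 1 non-zero multiples of some `X`,
  -- whence the extra factor in the exponent `r + 1`. A fixed `X` occurs with a fraction of at most
  -- q^(-(|ι|+r)) of the `M`, and there are fewer than q^|ι| choices of `X`.
  let G : (ι → σ → F) → {X : ι → F // X ≠ 0} → Prop :=
    fun M X => y X.1 + ∑ a, (∑ i, X.1 i * M i a) • g a ∈ D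
  have hlow : ∀ M : ι → σ → F, (∃ X ≠ 0, y X + ∑ a, (∑ i, X i * M i a) • g a ∈ D) →
      Fintype.card F - 1 ≤ (Finset.univ.filter fun X => G M X).card := by
    rintro M ⟨X, hX, hXD⟩
    rw [← Fintype.card_units, ← Fintype.card_subtype]
    refine Fintype.card_le_of_injective (fun u : Fˣ =>
      (⟨⟨(u : F) • X, smul_ne_zero u.ne_zero hX⟩, ?_⟩ : {X // G M X})) ?_
    · have h : y ((u : F) • X) + ∑ a, (∑ i, ((u : F) • X) i * M i a) • g a =
          (u : F) • (y X + ∑ a, (∑ i, X i * M i a) • g a) := by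
        rw [smul_add, map_smul, Finset.smul_sum]
        congr 1
        refine Finset.sum_congr rfl fun a _ => ?_
        rw [smul_smul, Finset.mul_sum]
        congr 1
        exact Finset.sum_congr rfl fun i _ => by simp [mul_assoc]
      change y ((u : F) • X) + ∑ a, (∑ i, ((u : F) • X) i * M i a) • g a ∈ D
      rw [h]
      exact D.smul_mem _ hXD
    · intro u u' h
      have h1 : (u : F) • X = (u' : F) • X := congrArg (fun z => z.1.1) h
      exact Units.ext (smul_left_injective F hX h1)
  have hup : ∀ X, (Finset.univ.filter fun M => G M X).card *
      Fintype.card F ^ (Fintype.card ι + r) ≤ Nat.card (ι → σ → F) := by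
    rintro ⟨X, hX⟩
    let f : (ι → σ → F) →ₗ[F] V ⧸ D := D.mkQ ∘ₗ Fintype.linearCombination F g ∘ₗ
      { toFun := fun M a => ∑ i, X i * M i a
        map_add' := fun M M' => by
          funext a; simp [mul_add, Finset.sum_add_distrib]
        map_smul' := fun u M => by
          funext a; simp only [Pi.smul_apply, smul_eq_mul, RingHom.id_apply, Finset.mul_sum]
          exact Finset.sum_congr rfl fun i _ => by ring }
    have hf : ∀ M, f M = D.mkQ (∑ a, (∑ i, X i * M i a) • g a) := fun M => by
      simp [f, Fintype.linearCombination_apply]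
    have hrange : LinearMap.range f = (span F (Set.range g)).map D.mkQ := by
      rw [LinearMap.range_comp, LinearMap.range_comp_of_range_eq_top,
        Fintype.range_linearCombination]
      rw [LinearMap.range_eq_top]
      intro z
      obtain ⟨i, hi⟩ := Function.ne_iff.1 hX
      simp only [Pi.zero_apply] at hi
      refine ⟨Pi.single i fun a => (X i)⁻¹ * z a, ?_⟩
      funext a
      change ∑ j, X j * (Pi.single i (fun a => (X i)⁻¹ * z a) : ι → σ → F) j a = z a
      rw [Finset.sum_eq_single i]
      · simp [hi]
      · intro j _ hj; simp [hj]
      · simp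
    have h1 := ncard_fiber_mul_pow_le f (-D.mkQ (y X)) (Fintype.card ι + r) (by
      rw [hrange]
      rw [finrank_sup_eq_add_finrank_map_mkQ] at hr
      omega)
    rw [Nat.card_eq_fintype_card (α := F)] at h1
    refine le_trans (le_of_eq ?_) h1
    congr 1
    rw [Set.ncard_eq_toFinset_card']
    congr 1
    ext M
    simp only [G, Finset.mem_filter, Finset.mem_univ, true_and, Set.mem_toFinset,
      Set.mem_ofPred_eq, hf]
    rw [eq_neg_iff_add_eq_zero, ← map_add, add_comm, Submodule.mkQ_apply,
      Submodule.Quotient.mk_eq_zero]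
  have hcount := Finset.sum_card_bipartiteAbove_eq_sum_card_bipartiteBelow (s := Finset.univ)
    (t := Finset.univ) G
  have hbad : {M : ι → σ → F | ∃ X ≠ 0, y X + ∑ a, (∑ i, X i * M i a) • g a ∈ D}.ncard *
      (Fintype.card F - 1) ≤ ∑ M, (Finset.univ.filter fun X => G M X).card := by
    rw [Set.ncard_eq_toFinset_card', ← smul_eq_mul]
    refine (Finset.card_nsmul_le_sum _ _ _ fun K hK => hlow K (by simpa using hK)).trans ?_
    exact Finset.sum_le_sum_of_subset (Finset.subset_univ _)
  set bad := {M : ι → σ → F | ∃ X ≠ 0, y X + ∑ a, (∑ i, X i * M i a) • g a ∈ D}.ncard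
  have hq : 0 < Fintype.card F := Fintype.card_pos
  have hX : Fintype.card {X : ι → F // X ≠ 0} ≤ Fintype.card F ^ Fintype.card ι := by
    rw [← Fintype.card_fun]
    exact Fintype.card_subtype_le _
  have hpow : 0 < Fintype.card F ^ Fintype.card ι := by positivity
  refine Nat.le_of_mul_le_mul_right ?_ hpow
  calc bad * (Fintype.card F - 1) ^ (r + 1) * Fintype.card F ^ Fintype.card ι
      = bad * (Fintype.card F - 1) * ((Fintype.card F - 1) ^ r * Fintype.card F ^ Fintype.card ι) :=
        by ring
    _ ≤ (∑ M, (Finset.univ.filter fun X => G M X).card) *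
        (Fintype.card F ^ r * Fintype.card F ^ Fintype.card ι) :=
        Nat.mul_le_mul hbad (Nat.mul_le_mul_right _ (Nat.pow_le_pow_left (Nat.sub_le _ _) _))
    _ = (∑ X, (Finset.univ.filter fun M => G M X).card) *
        Fintype.card F ^ (Fintype.card ι + r) := by
        rw [← pow_add, add_comm r]
        exact congrArg (· * _) hcount
    _ ≤ ∑ _X : {X : ι → F // X ≠ 0}, Nat.card (ι → σ → F) := by
        rw [Finset.sum_mul]
        exact Finset.sum_le_sum fun X _ => hup X
    _ ≤ Nat.card (ι → σ → F) * Fintype.card F ^ Fintype.card ι := by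
        rw [Finset.sum_const, smul_eq_mul, Finset.card_univ, mul_comm]
        exact Nat.mul_le_mul_left _ hX

end LinearAlgebra

/-! ### Cuts and linked sets of channels -/

namespace Network

variable {V E : Type*} (N : Network V E)

section Cuts

variable [Fintype E]

open Classical in
/-- The channels of `S` through which a signal may leave `S` or arrive at `t`. -/
noncomputable def boundary (t : V) (S : Finset E) : Finset E :=
  S.filter fun e => N.head e = t ∨ ∃ g, g ∉ S ∧ N.head e = N.tail g

/-- The channels of `B` are linked to `t`: no set of fewer than `|B|` channels separates `B` from
`t`. -/
def Linked (t : V) (B : Finset E) : Prop :=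
  ∀ S, B ⊆ S → B.card ≤ (N.boundary t S).card

variable {N} {t : V}

theorem mem_boundary {S : Finset E} {e : E} :
    e ∈ N.boundary t S ↔ e ∈ S ∧ (N.head e = t ∨ ∃ g, g ∉ S ∧ N.head e = N.tail g) := by
  simp [boundary]

theorem boundary_subset (S : Finset E) : N.boundary t S ⊆ S := fun _ he => (mem_boundary.1 he).1

/-- Submodularity of the cut function: a channel in either boundary on the left lies in one of those
on the right, and a channel in both on the left lies in both on the right. -/
theorem card_boundary_union_add_inter_le [DecidableEq E] (S T : Finset E) :
    (N.boundary t (S ∪ T)).card + (N.boundary t (S ∩ T)).card ≤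
      (N.boundary t S).card + (N.boundary t T).card := by
  rw [← Finset.card_union_add_card_inter (N.boundary t (S ∪ T)),
    ← Finset.card_union_add_card_inter (N.boundary t S)]
  refine Nat.add_le_add (Finset.card_le_card fun e => ?_) (Finset.card_le_card fun e => ?_)
  all_goals
    simp only [Finset.mem_union, Finset.mem_inter, mem_boundary]
    grind

theorem linked_empty : N.Linked t ∅ := fun _ _ => by simp

/-- Augmentation: a linked set inside `X` extends within `X` up to the capacity of `X`. -/
theorem Linked.exists_extension [DecidableEq E] {B X : Finset E} (hB : N.Linked t B) (hBX : B ⊆ X)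
    {n : ℕ} (hX : ∀ S, X ⊆ S → n ≤ (N.boundary t S).card) (hn : B.card ≤ n) :
    ∃ B', B ⊆ B' ∧ B' ⊆ X ∧ B'.card = n ∧ N.Linked t B' := by
  induction n, hn using Nat.le_induction with
  | base => exact ⟨B, subset_rfl, hBX, rfl, hB⟩
  | succ n hn ih =>
    obtain ⟨B', hBB', hB'X, hcard, hl⟩ := ih fun S hS => (Nat.le_succ n).trans (hX S hS)
    by_contra hcon
    push Not at hcon
    -- If no channel of `X` can be added to `B'`, each of them lies together with `B'` in a tight
    -- set, one with boundary of size at most `n`.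
    have htight : ∀ e ∈ X, ∃ S, insert e B' ⊆ S ∧ (N.boundary t S).card ≤ n := by
      intro e he
      by_cases heB : e ∈ B'
      · exact ⟨B', by simp [heB], hcard ▸ Finset.card_le_card (boundary_subset _)⟩
      · have hc : (insert e B').card = n + 1 := by rw [Finset.card_insert_of_notMem heB, hcard]
        have := hcon (insert e B') (hBB'.trans (Finset.subset_insert _ _))
          (Finset.insert_subset he hB'X) hc
        simp only [Linked, not_forall, not_le] at this
        obtain ⟨S, hS, hlt⟩ := this
        exact ⟨S, hS, by omega⟩
    -- Tight sets are closed under union: their intersection contains the linked set `B'`, so its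
    -- boundary has at least `n` elements, and submodularity applies. Their union over `X`
    -- contradicts the capacity `n + 1` of `X`.
    have hunion : ∀ Y ⊆ X, ∃ S, Y ∪ B' ⊆ S ∧ (N.boundary t S).card ≤ n := by
      intro Y
      induction Y using Finset.induction_on with
      | empty => exact fun _ => ⟨B', by simp, hcard ▸ Finset.card_le_card (boundary_subset _)⟩
      | insert e Y _ ih =>
        intro hY
        obtain ⟨S, hS, hSn⟩ := ih ((Finset.subset_insert _ _).trans hY)
        obtain ⟨T, hT, hTn⟩ := htight e (hY (Finset.mem_insert_self _ _))
        refine ⟨S ∪ T, ?_, ?_⟩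
        · intro a ha
          have h1 := @hS a
          have h2 := @hT a
          simp only [Finset.mem_union, Finset.mem_insert] at *
          tauto
        · have h1 := card_boundary_union_add_inter_le (N := N) (t := t) S T
          have h2 := hl (S ∩ T) (Finset.subset_inter
            (Finset.subset_union_right.trans hS) ((Finset.subset_insert _ _).trans hT))
          omega
    obtain ⟨S, hS, hSn⟩ := hunion X subset_rfl
    have := hX S (Finset.subset_union_left.trans hS)
    omega

/-- A set of channels that contains all outgoing channels of the source has a boundary at least as
large as the minimum cut. -/
theorem minCut_le_card_boundary (ht : t ∈ N.sinks) {S : Finset E}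
    (hS : ∀ e, N.tail e = N.source → e ∈ S) : N.minCut t ≤ (N.boundary t S).card := by
  refine Nat.sInf_le ⟨N.boundary t S, ?_, rfl⟩
  intro hpath
  -- A path from the source that avoids the boundary can never leave `S`, hence cannot arrive at
  -- `t`.
  have key : ∀ u, Relation.ReflTransGen
      (fun u v => ∃ e, e ∉ N.boundary t S ∧ N.tail e = u ∧ N.head e = v) N.source u →
      u = N.source ∨ ∃ e ∈ S, e ∉ N.boundary t S ∧ N.head e = u := by
    intro u hu
    induction hu with
    | refl => exact Or.inl rfl
    | tail _ h ih =>
      obtain ⟨g, hg, rfl, rfl⟩ := h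
      refine Or.inr ⟨g, ?_, hg, rfl⟩
      rcases ih with h | ⟨e, heS, heb, he⟩
      · exact hS g h
      · by_contra hgS
        exact heb (mem_boundary.2 ⟨heS, Or.inr ⟨g, hgS, he⟩⟩)
  rcases key t hpath with h | ⟨e, heS, heb, he⟩
  · exact N.source_notMem_sinks (h ▸ ht)
  · exact heb (mem_boundary.2 ⟨heS, Or.inl he⟩)

/-- A linked set can be pushed through the node `v`: its channels entering `v` are exchanged for
channels leaving `v`. -/
theorem Linked.exists_push [DecidableEq E] [DecidableEq V] {B : Finset E} (hB : N.Linked t B)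
    {v : V} (hv : v ≠ t) :
    ∃ B', B.filter (fun e => N.head e ≠ v) ⊆ B' ∧
      (∀ e ∈ B', e ∉ B.filter (fun e => N.head e ≠ v) → N.tail e = v) ∧
      B'.card = B.card ∧ N.Linked t B' := by
  set R := B.filter (fun e => N.head e ≠ v) with hR
  -- Linkedness passes to subsets: adjoining `B \ R` to `S` enlarges the boundary by at most |B \
  -- R|.
  have hRl : N.Linked t R := by
    intro S hS
    have h1 := hB (S ∪ B) Finset.subset_union_right
    have h2 : N.boundary t (S ∪ B) ⊆ N.boundary t S ∪ (B \ R) := by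
      intro e
      have := @hS e
      simp only [Finset.mem_union, Finset.mem_sdiff, mem_boundary]
      grind
    have h3 := (Finset.card_le_card h2).trans (Finset.card_union_le _ _)
    have h4 := Finset.card_sdiff_add_card_eq_card (Finset.filter_subset (fun e => N.head e ≠ v) B)
    rw [← hR] at h4
    omega
  obtain ⟨B', h1, h2, h3, h4⟩ := hRl.exists_extension
    (X := R ∪ Finset.univ.filter fun e => N.tail e = v) Finset.subset_union_left (n := B.card)
    (by
      intro S hS
      -- Channels of `B` outside `S` enter `v`, while all channels leaving `v` are in `S` and `v ≠
      -- t`. So they are not in the boundary of `S ∪ B`.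
      refine (hB (S ∪ B) Finset.subset_union_right).trans (Finset.card_le_card fun e => ?_)
      simp only [mem_boundary, Finset.mem_union]
      rintro ⟨he, hor⟩
      have heS : e ∈ S := by
        by_contra heS
        have heB : e ∈ B := he.resolve_left heS
        have hev : N.head e = v := by
          by_contra hev
          exact heS (hS (Finset.mem_union_left _ (Finset.mem_filter.2 ⟨heB, hev⟩)))
        rcases hor with h | ⟨g, hg, hge⟩
        · exact hv (hev.symm.trans h)
        · exact hg (Or.inl (hS (Finset.mem_union_right _ (by simp [← hge, hev]))))
      refine ⟨heS, hor.imp_right ?_⟩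
      rintro ⟨g, hg, hge⟩
      exact ⟨g, fun h => hg (Or.inl h), hge⟩)
    (Finset.card_le_card (Finset.filter_subset _ _))
  refine ⟨B', h1, fun e he heR => ?_, h3, h4⟩
  have := h2 he
  simp only [Finset.mem_union, Finset.mem_filter, Finset.mem_univ, true_and] at this
  exact this.resolve_left heR

end Cuts

end Network

/-! ### Propagation of errors and messages to the sink -/

namespace Network

variable {V E : Type*} {N : Network V E}

section Transfer

variable {F : Type*} [Field F] {w : ℕ}

open Classical in
/-- The local encoding coefficient from the channel `a` to the channel `g`, zero if they are not
adjacent. -/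
noncomputable def coeff (c : N.Code w F) (a g : E) : F :=
  if h : N.head a = N.tail g then c ⟨(Sum.inr a, g), h⟩ else 0

open Classical in
/-- The local encoding coefficient from the `i`-th message channel to the channel `g`, zero if `g`
does not start at the source. -/
noncomputable def msgCoeff (c : N.Code w F) (i : Fin w) (g : E) : F :=
  if h : N.tail g = N.source then c ⟨(Sum.inl i, g), h⟩ else 0

theorem coeff_of_ne (c : N.Code w F) {a g : E} (h : N.head a ≠ N.tail g) : coeff c a g = 0 :=
  dif_neg h

theorem coeff_of_eq (c : N.Code w F) {a g : E} (h : N.head a = N.tail g) :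
    coeff c a g = c ⟨(Sum.inr a, g), h⟩ := dif_pos h

theorem msgCoeff_of_ne (c : N.Code w F) {i : Fin w} {g : E} (h : N.tail g ≠ N.source) :
    msgCoeff c i g = 0 := dif_neg h

theorem msgCoeff_of_eq (c : N.Code w F) {i : Fin w} {g : E} (h : N.tail g = N.source) :
    msgCoeff c i g = c ⟨(Sum.inl i, g), h⟩ := dif_pos h

theorem coeff_add (c c' : N.Code w F) (a g : E) :
    coeff (c + c') a g = coeff c a g + coeff c' a g := by
  by_cases h : N.head a = N.tail g <;> simp [coeff, h]

theorem msgCoeff_add (c c' : N.Code w F) (i : Fin w) (g : E) :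
    msgCoeff (c + c') i g = msgCoeff c i g + msgCoeff c' i g := by
  by_cases h : N.tail g = N.source <;> simp [msgCoeff, h]

variable [Fintype E]

/-- The reverse adjacency relation of channels is well founded. -/
theorem wf_channels_swap (N : Network V E) :
    WellFounded fun e d : E => N.head d = N.tail e := by
  have : Std.Irrefl (Relation.TransGen fun e d : E => N.head d = N.tail e) := by
    refine ⟨fun e he => ?_⟩
    have h1 : Relation.TransGen (fun d e : E => N.head d = N.tail e) e e :=
      Relation.transGen_swap.1 he
    exact (N.wf_channels.transGen).irrefl.irrefl e h1
  have wf : WellFounded (Relation.TransGen fun e d : E => N.head d = N.tail e) :=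
    Finite.wellFounded_of_trans_of_irrefl _
  exact Subrelation.wf (r := Relation.TransGen fun e d : E => N.head d = N.tail e)
    (fun {_ _} h => Relation.TransGen.single h) wf

open Classical in
theorem extKernel_inr (c : N.Code w F) (a e : E) :
    N.extKernel c e (Sum.inr a) =
      (if a = e then 1 else 0) + ∑ d, coeff c d e * N.extKernel c d (Sum.inr a) := by
  rw [extKernel_eq]
  simp only [Pi.add_apply, Finset.sum_apply]
  have h1 : ∀ i : Fin w, (if h : N.tail e = N.source
      then c ⟨(Sum.inl i, e), h⟩ • (Pi.single (Sum.inl i) (1 : F) : Fin w ⊕ E → F) else 0)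
      (Sum.inr a) = 0 := by
    intro i; split_ifs <;> simp
  have h2 : ∀ d : E, (if h : N.head d = N.tail e
      then c ⟨(Sum.inr d, e), h⟩ • N.extKernel c d else 0) (Sum.inr a) =
      coeff c d e * N.extKernel c d (Sum.inr a) := by
    intro d; unfold coeff; split_ifs <;> simp
  simp only [h1, h2, Finset.sum_const_zero, zero_add]
  rw [add_comm]
  congr 1
  simp [Pi.single_apply]

theorem extKernel_inl (c : N.Code w F) (i : Fin w) (e : E) :
    N.extKernel c e (Sum.inl i) =
      msgCoeff c i e + ∑ d, coeff c d e * N.extKernel c d (Sum.inl i) := by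
  classical
  rw [extKernel_eq]
  simp only [Pi.add_apply, Finset.sum_apply]
  have h1 : ∀ j : Fin w, (if h : N.tail e = N.source
      then c ⟨(Sum.inl j, e), h⟩ • (Pi.single (Sum.inl j) (1 : F) : Fin w ⊕ E → F) else 0)
      (Sum.inl i) = if i = j then msgCoeff c i e else 0 := by
    intro j
    unfold msgCoeff
    by_cases h : N.tail e = N.source <;> by_cases hij : i = j <;> simp [h, hij]
  have h2 : ∀ d : E, (if h : N.head d = N.tail e
      then c ⟨(Sum.inr d, e), h⟩ • N.extKernel c d else 0) (Sum.inl i) =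
      coeff c d e * N.extKernel c d (Sum.inl i) := by
    intro d; unfold coeff; split_ifs <;> simp
  simp only [h1, h2]
  simp

open Classical in
/-- The transfer coefficients satisfy the recursion on the first channel as well. -/
theorem extKernel_inr_left (c : N.Code w F) (a e : E) :
    N.extKernel c e (Sum.inr a) =
      (if a = e then 1 else 0) + ∑ g, coeff c a g * N.extKernel c e (Sum.inr g) := by
  induction e using N.wf_channels.induction with
  | _ e ih =>
    have h1 : ∀ d, coeff c d e * N.extKernel c d (Sum.inr a) =
        coeff c d e * (if a = d then 1 else 0) +
          ∑ g, coeff c a g * (coeff c d e * N.extKernel c d (Sum.inr g)) := by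
      intro d
      by_cases h : N.head d = N.tail e
      · rw [ih d h, mul_add, Finset.mul_sum]
        congr 1
        exact Finset.sum_congr rfl fun g _ => by ring
      · simp [coeff_of_ne c h]
    have h2 : ∀ g, coeff c a g * N.extKernel c e (Sum.inr g) =
        coeff c a g * (if g = e then 1 else 0) +
          ∑ d, coeff c a g * (coeff c d e * N.extKernel c d (Sum.inr g)) := by
      intro g
      rw [extKernel_inr, mul_add, Finset.mul_sum]
    rw [extKernel_inr, Finset.sum_congr rfl fun d _ => h1 d, Finset.sum_congr rfl fun g _ => h2 g,
      Finset.sum_add_distrib, Finset.sum_add_distrib, Finset.sum_comm]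
    simp

/-- A message symbol acts like an error injected on the channels leaving the source, with the
message coefficients as amplitudes. So messages and errors are both expressed by the rows of real
channels. -/
theorem extKernel_inl_eq_sum (c : N.Code w F) (i : Fin w) (e : E) :
    N.extKernel c e (Sum.inl i) = ∑ a, msgCoeff c i a * N.extKernel c e (Sum.inr a) := by
  classical
  induction e using N.wf_channels.induction with
  | _ e ih =>
    have h1 : ∀ d, coeff c d e * N.extKernel c d (Sum.inl i) =
        ∑ a, msgCoeff c i a * (coeff c d e * N.extKernel c d (Sum.inr a)) := by
      intro d
      by_cases h : N.head d = N.tail e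
      · rw [ih d h, Finset.mul_sum]
        exact Finset.sum_congr rfl fun g _ => by ring
      · simp [coeff_of_ne c h]
    have h2 : ∀ a, msgCoeff c i a * N.extKernel c e (Sum.inr a) =
        msgCoeff c i a * (if a = e then 1 else 0) +
          ∑ d, msgCoeff c i a * (coeff c d e * N.extKernel c d (Sum.inr a)) := by
      intro g
      rw [extKernel_inr, mul_add, Finset.mul_sum]
    rw [extKernel_inl, Finset.sum_congr rfl fun d _ => h1 d, Finset.sum_congr rfl fun g _ => h2 g,
      Finset.sum_add_distrib, Finset.sum_comm]
    simp

/-- The row of the decoding matrix at `t` that belongs to the channel `a`: the effect at `t` of a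
unit error on `a`. -/
noncomputable def row (c : N.Code w F) (t : V) (a : E) : N.InCh t → F :=
  N.decodingMatrix c t (Sum.inr a)

theorem row_apply (c : N.Code w F) (t : V) (a : E) (e : N.InCh t) :
    row c t a e = N.extKernel c e.1 (Sum.inr a) := rfl

theorem row_of_head_ne (c : N.Code w F) {t : V} {a : E} (h : N.head a ≠ t) :
    row c t a = ∑ g, coeff c a g • row c t g := by
  funext e
  have hae : a ≠ e.1 := fun he => h (he ▸ e.2)
  rw [row_apply, extKernel_inr_left]
  simp [hae, Finset.sum_apply, row_apply]

open Classical in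
theorem row_of_head_eq (c : N.Code w F) {t : V} (ht : t ∈ N.sinks) {a : E} (h : N.head a = t) :
    row c t a = Pi.single ⟨a, h⟩ 1 := by
  funext e
  rw [row_apply, extKernel_inr_left]
  have h0 : ∀ g, coeff c a g = 0 := fun g =>
    coeff_of_ne c fun hg => N.no_out_sink g (hg ▸ h ▸ ht)
  simp only [h0, zero_mul, Finset.sum_const_zero, add_zero, Pi.single_apply]
  congr 1
  simp [Subtype.ext_iff, eq_comm]

/-- The rows of a successor-closed set of channels depend only on the coefficients out of this
set. -/
theorem row_congr {c c' : N.Code w F} {t : V} (S : Set E)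
    (hS : ∀ a ∈ S, ∀ g, N.head a = N.tail g → g ∈ S)
    (hc : ∀ a ∈ S, ∀ g, coeff c a g = coeff c' a g) {a : E} (ha : a ∈ S) :
    row c t a = row c' t a := by
  classical
  funext e
  induction a using N.wf_channels_swap.induction with
  | _ a ih =>
    rw [row_apply, row_apply, extKernel_inr_left, extKernel_inr_left]
    congr 1
    refine Finset.sum_congr rfl fun g _ => ?_
    by_cases h : N.head a = N.tail g
    · rw [hc a ha g]
      congr 1
      exact ih g h (hS a ha g h)
    · simp [coeff_of_ne _ h]

theorem vecMul_decodingMatrix (c : N.Code w F) (t : V) (X : Fin w → F) (Z : E → F) :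
    Matrix.vecMul (Sum.elim X Z) (N.decodingMatrix c t) =
      ∑ a, (Z a + ∑ i, X i * msgCoeff c i a) • row c t a := by
  funext e
  simp only [Matrix.vecMul, dotProduct, Fintype.sum_sum_type, Sum.elim_inl, Sum.elim_inr,
    Finset.sum_apply, Pi.smul_apply, smul_eq_mul, add_mul, Finset.sum_add_distrib]
  rw [add_comm]
  congr 1
  have h : ∀ i, X i * N.decodingMatrix c t (Sum.inl i) e =
      ∑ a, X i * msgCoeff c i a * row c t a e := by
    intro i
    change X i * N.extKernel c e.1 (Sum.inl i) = _
    rw [extKernel_inl_eq_sum, Finset.mul_sum]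
    exact Finset.sum_congr rfl fun a _ => by rw [row_apply, mul_assoc]
  rw [Finset.sum_congr rfl fun i _ => h i, Finset.sum_comm]
  exact Finset.sum_congr rfl fun a _ => by rw [Finset.sum_mul]

theorem errorSpace_eq_span (c : N.Code w F) (t : V) (ρ : Finset E) :
    N.errorSpace c t ρ = Submodule.span F (row c t '' (ρ : Set E)) := by
  classical
  have key : ∀ Z : E → F, Matrix.vecMul (Sum.elim (0 : Fin w → F) Z) (N.decodingMatrix c t) =
      ∑ a, Z a • row c t a := fun Z => by simp [vecMul_decodingMatrix]
  apply le_antisymm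
  · rintro v ⟨Z, hZ, rfl⟩
    rw [key]
    refine Submodule.sum_mem _ fun a _ => ?_
    by_cases ha : a ∈ ρ
    · exact Submodule.smul_mem _ _ (Submodule.subset_span ⟨a, ha, rfl⟩)
    · simp [hZ a ha]
  · rw [Submodule.span_le]
    rintro _ ⟨a, ha, rfl⟩
    refine ⟨Pi.single a 1, fun e he => ?_, ?_⟩
    · rw [Pi.single_apply, if_neg]
      rintro rfl
      exact he ha
    · rw [key]
      simp [Pi.single_apply]

theorem row_mem_errorSpace (c : N.Code w F) (t : V) {ρ : Finset E} {a : E} (ha : a ∈ ρ) :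
    row c t a ∈ N.errorSpace c t ρ := by
  rw [errorSpace_eq_span]; exact Submodule.subset_span ⟨a, ha, rfl⟩

theorem errorSpace_mono (c : N.Code w F) (t : V) {ρ ρ' : Finset E} (h : ρ ⊆ ρ') :
    N.errorSpace c t ρ ≤ N.errorSpace c t ρ' := by
  rw [errorSpace_eq_span, errorSpace_eq_span]
  exact Submodule.span_mono (Set.image_mono (Finset.coe_subset.2 h))

theorem finrank_errorSpace_le (c : N.Code w F) (t : V) (ρ : Finset E) :
    Module.finrank F (N.errorSpace c t ρ) ≤ ρ.card := by
  classical
  rw [errorSpace_eq_span, ← Finset.coe_image]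
  exact (finrank_span_finset_le_card _).trans Finset.card_image_le

theorem errorSpace_union [DecidableEq E] (c : N.Code w F) (t : V) (ρ ρ' : Finset E) :
    N.errorSpace c t (ρ ∪ ρ') = N.errorSpace c t ρ ⊔ N.errorSpace c t ρ' := by
  rw [errorSpace_eq_span, errorSpace_eq_span, errorSpace_eq_span, Finset.coe_union,
    Set.image_union, Submodule.span_union]

theorem finrank_errorSpace_of_forall_head_eq (c : N.Code w F) {t : V} (ht : t ∈ N.sinks)
    {B : Finset E} (hB : ∀ e ∈ B, N.head e = t) :
    Module.finrank F (N.errorSpace c t B) = B.card := by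
  classical
  have hli : LinearIndependent F fun a : B => row c t a.1 := by
    have h1 : (fun a : B => row c t a.1) =
        (fun e : N.InCh t => (Pi.single e 1 : N.InCh t → F)) ∘
          fun a : B => ⟨a.1, hB a.1 a.2⟩ := by
      funext a
      exact row_of_head_eq c ht (hB a.1 a.2)
    rw [h1]
    refine (Pi.linearIndependent_single_one (N.InCh t) F).comp _ fun a b h => ?_
    exact Subtype.ext (congrArg (fun e => e.1) h)
  have := finrank_span_eq_card hli
  rw [errorSpace_eq_span]
  have h2 : row c t '' (B : Set E) = Set.range fun a : B => row c t a.1 := by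
    ext v; simp
  rw [h2, this, Fintype.card_coe]

/-- An error pattern is dominated by the boundary of every set of channels that contains it. -/
theorem dominated_boundary (w : ℕ) (t : V) {ρ S : Finset E} (h : ρ ⊆ S) :
    N.Dominated F w t ρ (N.boundary t S) := by
  intro c
  -- Downstream induction: a channel of `S` off the boundary does not end at `t` and has all its
  -- successors in `S`, so its row is a combination of theirs.
  have key : ∀ a, a ∈ S → row c t a ∈ N.errorSpace c t (N.boundary t S) := by
    intro a
    induction a using N.wf_channels_swap.induction with
    | _ a ih =>
      intro ha
      by_cases hb : a ∈ N.boundary t S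
      · exact row_mem_errorSpace c t hb
      · have hne : N.head a ≠ t := fun h => hb (mem_boundary.2 ⟨ha, Or.inl h⟩)
        rw [row_of_head_ne c hne]
        refine Submodule.sum_mem _ fun g _ => ?_
        by_cases hg : N.head a = N.tail g
        · refine Submodule.smul_mem _ _ (ih g hg ?_)
          by_contra hgS
          exact hb (mem_boundary.2 ⟨ha, Or.inr ⟨g, hgS, hg⟩⟩)
        · simp [coeff_of_ne c hg]
  rw [errorSpace_eq_span c t ρ, Submodule.span_le]
  rintro _ ⟨a, ha, rfl⟩
  exact key a (h ha)

theorem patternRank_le {w : ℕ} {t : V} {ρ ρ' : Finset E} (h : N.Dominated F w t ρ ρ') :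
    N.patternRank F w t ρ ≤ ρ'.card := Nat.sInf_le ⟨ρ', h, rfl⟩

theorem exists_dominated_card_eq (F : Type*) [Field F] (w : ℕ) (t : V) (ρ : Finset E) :
    ∃ ρ' : Finset E, N.Dominated F w t ρ ρ' ∧ ρ'.card = N.patternRank F w t ρ :=
  Nat.sInf_mem (s := {n | ∃ ρ' : Finset E, N.Dominated F w t ρ ρ' ∧ ρ'.card = n})
    ⟨_, ρ, fun _ => le_rfl, rfl⟩

/-- A boundary smaller than `ρ` of a set containing `ρ` would dominate `ρ` and lower its rank. -/
theorem linked_of_patternRank_eq_card {w : ℕ} {t : V} {ρ : Finset E}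
    (h : N.patternRank F w t ρ = ρ.card) : N.Linked t ρ :=
  fun _ hS => h ▸ patternRank_le (dominated_boundary w t hS)

end Transfer

/-! ### Rank distribution of linked sets and confusion of messages in random codes -/

section RandomCodes

variable {F : Type*} [Field F] {w : ℕ}

open Classical in
/-- The code whose only non-zero coefficients are those from `A` to `A'`, given by a matrix. -/
noncomputable def transferCode (N : Network V E) (w : ℕ) {A A' : Finset E} (M : Matrix A A' F) :
    N.Code w F
  | ⟨(Sum.inl _, _), _⟩ => 0
  | ⟨(Sum.inr a, g), _⟩ => if h : a ∈ A ∧ g ∈ A' then M ⟨a, h.1⟩ ⟨g, h.2⟩ else 0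

open Classical in
/-- The code whose only non-zero coefficients are those from the message channels to `σ`. -/
noncomputable def sourceCode (N : Network V E) {σ : Finset E} (M : Fin w → σ → F) :
    N.Code w F
  | ⟨(Sum.inl i, g), _⟩ => if h : g ∈ σ then M i ⟨g, h⟩ else 0
  | ⟨(Sum.inr _, _), _⟩ => 0

theorem coeff_transferCode_of_mem {A A' : Finset E} (M : Matrix A A' F) (a : A) (g : A')
    (h : N.head a.1 = N.tail g.1) : coeff (N.transferCode w M) a.1 g.1 = M a g := by
  rw [coeff_of_eq _ h]
  simp [transferCode]

theorem coeff_transferCode_of_notMem {A A' : Finset E} (M : Matrix A A' F) {a g : E}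
    (h : ¬(a ∈ A ∧ g ∈ A')) : coeff (N.transferCode w M) a g = 0 := by
  by_cases hag : N.head a = N.tail g
  · rw [coeff_of_eq _ hag]
    simp [transferCode, h]
  · exact coeff_of_ne _ hag

theorem coeff_sourceCode {σ : Finset E} (M : Fin w → σ → F) (a g : E) :
    coeff (N.sourceCode M) a g = 0 := by
  by_cases hag : N.head a = N.tail g
  · rw [coeff_of_eq _ hag]
    simp [sourceCode]
  · exact coeff_of_ne _ hag

open Classical in
theorem msgCoeff_sourceCode {σ : Finset E} (hσ : ∀ e ∈ σ, N.tail e = N.source)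
    (M : Fin w → σ → F) (i : Fin w) (g : E) :
    msgCoeff (N.sourceCode M) i g = if h : g ∈ σ then M i ⟨g, h⟩ else 0 := by
  by_cases hg : N.tail g = N.source
  · rw [msgCoeff_of_eq _ hg]
    simp [sourceCode]
  · rw [msgCoeff_of_ne _ hg, dif_neg fun h => hg (hσ g h)]

/-- A non-empty set of nodes contains a node without predecessor in the set. -/
theorem exists_forall_head_ne [Finite V] (N : Network V E) {U : Set V} (hU : U.Nonempty) :
    ∃ v ∈ U, ∀ g, N.tail g ∈ U → N.head g ≠ v := by
  let r : V → V → Prop := fun a b => ∃ e, N.tail e = a ∧ N.head e = b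
  have : Std.Irrefl (Relation.TransGen r) := ⟨N.acyclic⟩
  have wf : WellFounded (Relation.TransGen r) := Finite.wellFounded_of_trans_of_irrefl _
  obtain ⟨v, hv, hmin⟩ := wf.has_min U hU
  exact ⟨v, hv, fun g hg hgv => hmin _ hg (Relation.TransGen.single ⟨g, rfl, hgv⟩)⟩

theorem head_mem_internalNodes_or [Fintype V] (N : Network V E) (g : E) :
    N.head g ∈ N.internalNodes ∨ N.head g ∈ N.sinks := by
  classical
  by_cases h : N.head g ∈ N.sinks
  · exact Or.inr h
  · exact Or.inl (by simp [internalNodes, h, N.no_in_source])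

theorem notMem_internalNodes [Fintype V] {t : V} (ht : t ∈ N.sinks) : t ∉ N.internalNodes := by
  simp [internalNodes, ht]

variable [Fintype E]

theorem row_add_sourceCode (c : N.Code w F) (t : V) {σ : Finset E} (M : Fin w → σ → F) (a : E) :
    row (c + N.sourceCode M) t a = row c t a :=
  row_congr Set.univ (fun _ _ _ _ => trivial)
    (fun a _ g => by rw [coeff_add, coeff_sourceCode, add_zero]) trivial

theorem errorSpace_add_sourceCode (c : N.Code w F) (t : V) {σ : Finset E} (M : Fin w → σ → F)
    (ρ : Finset E) : N.errorSpace (c + N.sourceCode M) t ρ = N.errorSpace c t ρ := by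
  rw [errorSpace_eq_span, errorSpace_eq_span]
  congr 1
  exact Set.image_congr fun a _ => row_add_sourceCode c t M a

theorem errorSpace_eq_span_range (c : N.Code w F) (t : V) (A : Finset E) :
    N.errorSpace c t A = Submodule.span F (Set.range fun a : A => row c t a.1) := by
  rw [errorSpace_eq_span]
  congr 1
  ext v; simp

open Module in
/-- Passing a node: a linked set `B` of channels is exchanged at the node `v` for a linked set
`B'`, whose rows do not depend on the coefficients from `A` to `A'`, so that randomising these
coefficients controls the loss of rank from `B'` to `B`. -/
theorem Linked.exists_step [Fintype F] {t : V} {B : Finset E} (hB : N.Linked t B)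
    {U : Set V} (htU : t ∉ U)
    (hU : ∀ g, N.tail g ∈ U → N.head g ∈ U ∨ N.head g ∈ N.sinks)
    (hBU : ∀ e ∈ B, N.head e ∈ U ∨ N.head e ∈ N.sinks)
    {v : V} (hv : v ∈ U) (hvU : ∀ g, N.tail g ∈ U → N.head g ≠ v) (w : ℕ) :
    ∃ B' A A' : Finset E, N.Linked t B' ∧ B'.card = B.card ∧
      (∀ e ∈ B', N.head e ≠ v ∧ (N.head e ∈ U ∨ N.head e ∈ N.sinks)) ∧
      ∀ c : N.Code w F,
        (∀ M : Matrix A A' F,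
          N.errorSpace (c + N.transferCode w M) t B' = N.errorSpace c t B') ∧
        (∀ x, {M : Matrix A A' F | finrank F (N.errorSpace (c + N.transferCode w M) t B) + x ≤
          finrank F (N.errorSpace c t B')}.ncard * (Fintype.card F - 1) ^ x ≤
            Nat.card (Matrix A A' F)) ∧
        ∃ M : Matrix A A' F, finrank F (N.errorSpace c t B') ≤
          finrank F (N.errorSpace (c + N.transferCode w M) t B) := by
  classical
  have hvt : v ≠ t := fun h => htU (h ▸ hv)
  obtain ⟨B', hRB', hnew, hcard, hl⟩ := hB.exists_push hvt
  set R := B.filter (fun e => N.head e ≠ v) with hR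
  have hRB : R ⊆ B := Finset.filter_subset _ _
  have hA : ∀ a ∈ B \ R, N.head a = v := by
    intro a ha
    simp only [hR, Finset.mem_sdiff, Finset.mem_filter, not_and, not_not] at ha
    exact ha.2 ha.1
  have hA' : ∀ g ∈ B' \ R, N.tail g = v := fun g hg =>
    hnew g (Finset.mem_sdiff.1 hg).1 (Finset.mem_sdiff.1 hg).2
  -- A successor-closed set without channels entering `v`; its rows are therefore unaffected by the
  -- coefficients from `B \ R` to `B' \ R`.
  let S : Set E := {a | N.head a ≠ v ∧ (N.head a ∈ U ∨ N.head a ∈ N.sinks)}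
  have hout : ∀ g, N.tail g ∈ U → g ∈ S := fun g hg => ⟨hvU g hg, hU g hg⟩
  have hSclosed : ∀ a ∈ S, ∀ g, N.head a = N.tail g → g ∈ S := by
    rintro a ⟨-, h⟩ g hg
    rcases h with h | h
    · exact hout g (hg ▸ h)
    · exact absurd (hg ▸ h) (N.no_out_sink g)
  have hRS : ∀ a ∈ R, a ∈ S := fun a ha =>
    ⟨(Finset.mem_filter.1 ha).2, hBU a (hRB ha)⟩
  have hB'S : ∀ e ∈ B', e ∈ S := by
    intro e he
    by_cases heR : e ∈ R
    · exact hRS e heR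
    · exact hout e (hnew e he heR ▸ hv)
  have hrow : ∀ (c : N.Code w F) (M : Matrix ↥(B \ R) ↥(B' \ R) F), ∀ a ∈ S,
      row (c + N.transferCode w M) t a = row c t a := by
    intro c M a ha
    refine row_congr S hSclosed (fun a ha g => ?_) ha
    rw [coeff_add, coeff_transferCode_of_notMem, add_zero]
    exact fun h => ha.1 (hA a h.1)
  have hspace : ∀ (c : N.Code w F) (M : Matrix ↥(B \ R) ↥(B' \ R) F) (Y : Finset E),
      (∀ a ∈ Y, a ∈ S) → N.errorSpace (c + N.transferCode w M) t Y = N.errorSpace c t Y := by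
    intro c M Y hY
    rw [errorSpace_eq_span, errorSpace_eq_span]
    congr 1
    exact Set.image_congr fun a ha => hrow c M a (hY a ha)
  have hrowA : ∀ (c : N.Code w F) (M : Matrix ↥(B \ R) ↥(B' \ R) F) (a : ↥(B \ R)),
      row (c + N.transferCode w M) t a.1 = row c t a.1 + ∑ g, M a g • row c t g.1 := by
    intro c M a
    have hav := hA a.1 a.2
    have hat : N.head a.1 ≠ t := hav ▸ hvt
    have h1 : ∀ g, coeff (c + N.transferCode w M) a.1 g • row (c + N.transferCode w M) t g =
        coeff c a.1 g • row c t g + coeff (N.transferCode w M) a.1 g • row c t g := by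
      intro g
      by_cases hg : N.head a.1 = N.tail g
      · rw [coeff_add, hrow c M g (hout g (by rw [← hg, hav]; exact hv)), add_smul]
      · simp [coeff_of_ne _ hg]
    rw [row_of_head_ne _ hat, row_of_head_ne c hat, Finset.sum_congr rfl fun g _ => h1 g,
      Finset.sum_add_distrib]
    congr 1
    rw [← Finset.sum_subset (Finset.subset_univ (B' \ R)) (fun g _ hg => by
      rw [coeff_transferCode_of_notMem _ fun h => hg h.2, zero_smul]),
      ← Finset.sum_coe_sort]
    refine Finset.sum_congr rfl fun g _ => ?_
    rw [coeff_transferCode_of_mem M a g (hav.trans (hA' g.1 g.2).symm)]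
  have hAcard : Fintype.card ↥(B \ R) = Fintype.card ↥(B' \ R) := by
    rw [Fintype.card_coe, Fintype.card_coe, Finset.card_sdiff_of_subset hRB,
      Finset.card_sdiff_of_subset hRB', hcard]
  have hC : ∀ c : N.Code w F, ∃ C : Matrix ↥(B \ R) ↥(B' \ R) F,
      ∀ M : Matrix ↥(B \ R) ↥(B' \ R) F,
        finrank F (N.errorSpace c t B') + (M + C).rank ≤
          finrank F (N.errorSpace (c + N.transferCode w M) t B) + Fintype.card ↥(B' \ R) := by
    intro c
    obtain ⟨C, hC⟩ := exists_finrank_sup_span_le (N.errorSpace c t R)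
      (fun g : ↥(B' \ R) => row c t g.1) (fun a : ↥(B \ R) => row c t a.1)
    refine ⟨C, fun M => ?_⟩
    have h := hC M
    have e1 : N.errorSpace c t B' = N.errorSpace c t R ⊔
        Submodule.span F (Set.range fun g : ↥(B' \ R) => row c t g.1) := by
      rw [← errorSpace_eq_span_range, ← errorSpace_union, Finset.union_sdiff_of_subset hRB']
    have e2 : N.errorSpace (c + N.transferCode w M) t B = N.errorSpace c t R ⊔
        Submodule.span F (Set.range fun a : ↥(B \ R) =>
          row c t a.1 + ∑ g, M a g • row c t g.1) := by
      have hsplit : ∀ c' : N.Code w F, N.errorSpace c' t B =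
          N.errorSpace c' t R ⊔ N.errorSpace c' t (B \ R) := fun c' => by
        rw [← errorSpace_union, Finset.union_sdiff_of_subset hRB]
      rw [hsplit, hspace c M R hRS, errorSpace_eq_span_range _ t (B \ R)]
      congr 3
      exact funext fun a => hrowA c M a
    rw [e1, e2]
    exact h
  refine ⟨B', B \ R, B' \ R, hl, hcard, hB'S, fun c => ⟨fun M => hspace c M B' hB'S, ?_, ?_⟩⟩
  · intro x
    obtain ⟨C, hC⟩ := hC c
    have : Finite (Matrix ↥(B \ R) ↥(B' \ R) F) :=
      inferInstanceAs (Finite (↥(B \ R) → ↥(B' \ R) → F))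
    refine le_trans (Nat.mul_le_mul_right _ ?_) (ncard_rank_add_le hAcard x)
    refine Set.ncard_le_ncard_of_injOn (fun M => M + C) (fun M hM => ?_)
      (fun _ _ _ _ h => add_right_cancel h) (Set.toFinite _)
    have h1 := hC M
    simp only [Set.mem_ofPred_eq] at hM ⊢
    omega
  · obtain ⟨C, hC⟩ := hC c
    -- This choice makes `M + C` a permutation matrix, so no rank is lost. It works over every
    -- field, also for q = 2, where the counting bounds are trivial.
    refine ⟨(1 : Matrix ↥(B' \ R) ↥(B' \ R) F).submatrix (Fintype.equivOfCardEq hAcard)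
      (Equiv.refl _) - C, ?_⟩
    have h := hC ((1 : Matrix ↥(B' \ R) ↥(B' \ R) F).submatrix (Fintype.equivOfCardEq hAcard)
      (Equiv.refl _) - C)
    rw [sub_add_cancel, Matrix.rank_submatrix, Matrix.rank_one] at h
    omega

/-- Taking `S = B`, linkedness forces every channel of `B` into its own boundary, and a channel
ending in a sink has no successor, so it can only end at `t`. -/
theorem Linked.head_eq {t : V} {B : Finset E} (hB : N.Linked t B)
    (hs : ∀ e ∈ B, N.head e ∈ N.sinks) {e : E} (he : e ∈ B) : N.head e = t := by
  have h := Finset.eq_of_subset_of_card_le (boundary_subset B) (hB B subset_rfl)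
  rw [← h] at he
  rcases (mem_boundary.1 he) with ⟨heB, h | ⟨g, -, hg⟩⟩
  · exact h
  · exact absurd (hg ▸ hs e heB) (N.no_out_sink g)

open Module in
/-- The rank distribution of a linked set of channels in a random code. -/
theorem Linked.rank_distribution [Finite V] [Fintype F] {t : V} (ht : t ∈ N.sinks) (w : ℕ)
    (U : Finset V) (htU : t ∉ U) (hU : ∀ g, N.tail g ∈ U → N.head g ∈ U ∨ N.head g ∈ N.sinks)
    {B : Finset E} (hB : N.Linked t B) (hBU : ∀ e ∈ B, N.head e ∈ U ∨ N.head e ∈ N.sinks) :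
    (∃ c : N.Code w F, finrank F (N.errorSpace c t B) = B.card) ∧
    ∀ k, {c : N.Code w F | finrank F (N.errorSpace c t B) + k ≤ B.card}.ncard *
      (Fintype.card F - 1) ^ k ≤ U.card.multichoose k * Nat.card (N.Code w F) := by
  classical
  induction hn : U.card generalizing U B with
  | zero =>
    have hU0 := Finset.card_eq_zero.1 hn
    subst hU0
    have hfull : ∀ c : N.Code w F, finrank F (N.errorSpace c t B) = B.card := fun c =>
      finrank_errorSpace_of_forall_head_eq c ht fun e he =>
        hB.head_eq (fun e he => (hBU e he).resolve_left (by simp)) he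
    refine ⟨⟨0, hfull 0⟩, fun k => ?_⟩
    simp only [hfull]
    cases k with
    | zero =>
      simp
    | succ k => simp
  | succ n ih =>
    -- Choosing `v` without predecessors in `U` keeps the rest of `U` closed under successors, up to
    -- sinks.
    obtain ⟨v, hvU, hv⟩ := N.exists_forall_head_ne (U := (U : Set V))
      (Finset.coe_nonempty.2 (Finset.card_pos.1 (by omega)))
    obtain ⟨B', A, A', hl, hcard, hheads, hstep⟩ := hB.exists_step (F := F) (U := (U : Set V))
      htU hU hBU hvU hv w
    obtain ⟨⟨c₀, hc₀⟩, hdist⟩ := ih (U.erase v) (fun h => htU (Finset.mem_of_mem_erase h))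
      (fun g hg => by
        have hgU := Finset.mem_of_mem_erase hg
        exact (hU g hgU).imp_left fun h => Finset.mem_erase.2 ⟨hv g hgU, h⟩) hl
      (fun e he => (hheads e he).2.imp_left fun h => Finset.mem_erase.2 ⟨(hheads e he).1, h⟩)
      (by rw [Finset.card_erase_of_mem hvU, hn]; rfl)
    constructor
    · obtain ⟨M, hM⟩ := (hstep c₀).2.2
      exact ⟨_, le_antisymm (finrank_errorSpace_le _ _ _) (by rw [← hcard, ← hc₀]; exact hM)⟩
    · intro k
      -- The earlier loss is that of the pushed set `B'`, known by induction and invariant under the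
      -- translations that randomise the coefficients at `v`.
      refine ncard_mul_pow_le_of_conditional
        (fun c : N.Code w F => finrank F (N.errorSpace c t B')) B.card (Fintype.card F - 1) n _ k
        (fun c => hcard ▸ finrank_errorSpace_le c t B') (fun j => hcard ▸ hdist j) _
        (fun j hj => ?_)
      have : Finite (Matrix A A' F) := inferInstanceAs (Finite (A → A' → F))
      refine ncard_inter_mul_le (fun M : Matrix A A' F => N.transferCode w M) _ _
        (fun c M => ?_) _ (fun c hc => ?_)
      · simp only [Set.mem_ofPred_eq]
        rw [(hstep c).1 M]
      · refine le_trans (Nat.mul_le_mul_right _ (Set.ncard_le_ncard (fun M hM => ?_)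
          (Set.toFinite _))) ((hstep c).2.1 (k - j))
        simp only [Set.mem_ofPred_eq] at hM hc ⊢
        omega

/-- Some code gives the error space of a linked `ρ` the full dimension |ρ|, and a dominating pattern
needs at least that many channels to contain this space. -/
theorem Linked.patternRank_eq_card [Fintype V] [Fintype F] {t : V} (ht : t ∈ N.sinks) (w : ℕ)
    {ρ : Finset E} (hρ : N.Linked t ρ) : N.patternRank F w t ρ = ρ.card := by
  refine le_antisymm (patternRank_le fun _ => le_rfl) ?_
  obtain ⟨c, hc⟩ := (hρ.rank_distribution (F := F) ht w _ (notMem_internalNodes ht)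
    (fun g _ => N.head_mem_internalNodes_or g) fun e _ => N.head_mem_internalNodes_or e).1
  obtain ⟨ρ', hdom, hcard⟩ := exists_dominated_card_eq (N := N) F w t ρ
  rw [← hcard, ← hc]
  exact (Submodule.finrank_mono (hdom c)).trans (finrank_errorSpace_le c t ρ')

/-- Some non-zero message is confused at `t` with an error matching `ρ`. -/
def Confusable (c : N.Code w F) (t : V) (ρ : Finset E) : Prop :=
  ∃ X : Fin w → F, X ≠ 0 ∧
    Matrix.vecMul (Sum.elim X (0 : E → F)) (N.decodingMatrix c t) ∈ N.errorSpace c t ρ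

open Module in
/-- For a linked error pattern `ρ` with `|ρ| + d + w = C_t`, a random code confuses a message with
an error matching `ρ` with small probability. -/
theorem Linked.ncard_confusable_mul_pow_le [Fintype V] [Fintype F] {t : V} (ht : t ∈ N.sinks)
    {ρ : Finset E} (hρ : N.Linked t ρ) {d : ℕ} (hd : ρ.card + d + w = N.minCut t) :
    {c : N.Code w F | Confusable c t ρ}.ncard * (Fintype.card F - 1) ^ (d + 1) ≤
      (N.internalNodes.card + 1).multichoose (d + 1) * Nat.card (N.Code w F) := by
  classical
  -- A set that contains `ρ` and all channels leaving the source has capacity at least `N.minCut t`;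
  -- so the channels added to `ρ` may all be taken at the source.
  obtain ⟨B, hρB, hBX, hBcard, hB⟩ := hρ.exists_extension
    (X := ρ ∪ Finset.univ.filter fun e => N.tail e = N.source) Finset.subset_union_left
    (n := N.minCut t)
    (fun S hS => minCut_le_card_boundary ht fun e he =>
      hS (Finset.mem_union_right _ (by simp [he]))) (by omega)
  have hσ : ∀ e ∈ B \ ρ, N.tail e = N.source := by
    intro e he
    have h1 := hBX (Finset.mem_sdiff.1 he).1
    have h2 := (Finset.mem_sdiff.1 he).2
    simpa [h2] using h1
  have hdist := (hB.rank_distribution (F := F) ht w _ (notMem_internalNodes ht)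
    (fun g _ => N.head_mem_internalNodes_or g) fun e _ => N.head_mem_internalNodes_or e).2
  refine ncard_mul_pow_le_of_conditional (fun c : N.Code w F => finrank F (N.errorSpace c t B))
    B.card (Fintype.card F - 1) _ _ (d + 1) (fun c => finrank_errorSpace_le c t B) hdist _
    (fun j hj => ?_)
  refine ncard_inter_mul_le (fun M : Fin w → ↥(B \ ρ) → F => N.sourceCode M) _ _
    (fun c M => ?_) _ (fun c hc => ?_)
  · simp only [Set.mem_ofPred_eq]
    rw [errorSpace_add_sourceCode]
  · let y : (Fin w → F) →ₗ[F] (N.InCh t → F) :=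
      { toFun := fun X => ∑ a, (∑ i, X i * msgCoeff c i a) • row c t a
        map_add' := fun X Y => by
          simp only [Pi.add_apply, add_mul, Finset.sum_add_distrib, add_smul]
        map_smul' := fun u X => by
          simp only [Pi.smul_apply, smul_eq_mul, RingHom.id_apply, Finset.smul_sum, smul_smul,
            Finset.mul_sum, mul_assoc] }
    have hsup : N.errorSpace c t B = N.errorSpace c t ρ ⊔
        Submodule.span F (Set.range fun a : ↥(B \ ρ) => row c t a.1) := by
      rw [← errorSpace_eq_span_range, ← errorSpace_union, Finset.union_sdiff_of_subset hρB]
    -- After a loss of `j` the rows of `B` span C_t - j = |ρ| + w + (d - j) dimensions, of which the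
    -- error space of `ρ` takes at most |ρ|. The remaining surplus is `d - j`.
    have hkey := ncard_exists_mem_mul_pow_le (ι := Fin w) (N.errorSpace c t ρ)
      (fun a : ↥(B \ ρ) => row c t a.1) y (d - j) (by
        rw [← hsup, Fintype.card_fin]
        have := finrank_errorSpace_le c t ρ
        simp only [Set.mem_ofPred_eq] at hc
        omega)
    rw [show d + 1 - j = d - j + 1 by omega]
    refine le_trans (Nat.mul_le_mul_right _ (le_of_eq ?_)) hkey
    congr 1
    ext M
    simp only [Set.mem_ofPred_eq, Confusable, errorSpace_add_sourceCode, vecMul_decodingMatrix,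
      row_add_sourceCode, Pi.zero_apply, zero_add, msgCoeff_add, mul_add, Finset.sum_add_distrib,
      add_smul]
    refine exists_congr fun X => and_congr_right fun _ => ?_
    have h1 : ∑ a, (∑ i, X i * msgCoeff (N.sourceCode M) i a) • row c t a =
        ∑ a : ↥(B \ ρ), (∑ i, X i * M i a) • row c t a.1 := by
      rw [← Finset.sum_subset (Finset.subset_univ (B \ ρ)) (fun a _ ha => by
        simp [msgCoeff_sourceCode hσ, ha]), ← Finset.sum_coe_sort]
      refine Finset.sum_congr rfl fun a _ => ?_
      have := a.2
      simp [msgCoeff_sourceCode hσ]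
    rw [h1]
    rfl

/-- If the minimum distance at `t` is at most `b`, then a linked error pattern of size and rank `b`
is confusable with a message. -/
theorem exists_confusable_of_minDist_le [Fintype V] [Fintype F] {t : V} (ht : t ∈ N.sinks)
    (hw : 1 ≤ w) {b : ℕ} (hb : b ≤ N.minCut t) (c : N.Code w F) (hc : N.minDist c t ≤ b) :
    ∃ ρ ∈ N.patternsOfRank F w t b, Confusable c t ρ := by
  classical
  -- Patterns of smaller rank are enlarged to size exactly `b`; this is possible because `b` does
  -- not exceed the minimum cut, and it is why only R_t(b) occurs in the bound.
  have hext : ∀ ρ : Finset E, N.Linked t ρ → ρ.card ≤ b →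
      ∃ ρ', ρ ⊆ ρ' ∧ ρ' ∈ N.patternsOfRank F w t b := by
    intro ρ hρ hρb
    obtain ⟨ρ', h1, -, h2, h3⟩ := hρ.exists_extension (Finset.subset_univ ρ) (n := b)
      (fun S hS => hb.trans (minCut_le_card_boundary ht fun e _ => hS (Finset.mem_univ e))) hρb
    refine ⟨ρ', h1, ?_⟩
    simp [patternsOfRank, h3.patternRank_eq_card ht w, h2]
  unfold minDist at hc
  split_ifs at hc with hdim
  · obtain ⟨ρ, -, hρ⟩ := hext ∅ linked_empty (by simp)
    refine ⟨ρ, hρ, ?_⟩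
    by_contra hcon
    have hinj : ∀ X : Fin w → F,
        Matrix.vecMul (Sum.elim X (0 : E → F)) (N.decodingMatrix c t) = 0 → X = 0 := by
      intro X hX
      by_contra hX0
      exact hcon ⟨X, hX0, by rw [hX]; exact zero_mem _⟩
    let f : (Fin w → F) →ₗ[F] (N.InCh t → F) :=
      (N.decodingMatrix c t).vecMulLinear ∘ₗ
        { toFun := fun X => Sum.elim X (0 : E → F)
          map_add' := fun X Y => by rw [← Sum.elim_add_add, add_zero]
          map_smul' := fun u X => by ext (i | e) <;> simp }
    have hf : LinearMap.range f = N.messageSpace c t := by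
      ext v
      exact ⟨fun ⟨X, hX⟩ => ⟨X, hX.symm⟩, fun ⟨X, hX⟩ => ⟨X, hX.symm⟩⟩
    have h := LinearMap.finrank_range_of_inj
      (LinearMap.ker_eq_bot.1 (LinearMap.ker_eq_bot'.2 hinj : LinearMap.ker f = ⊥))
    rw [hf, Module.finrank_fin_fun] at h
    omega
  · have hne : {r | ∃ ρ : Finset E,
        0 < Module.finrank F ↥(N.errorSpace c t ρ ⊓ N.messageSpace c t) ∧
          N.patternRank F w t ρ = r}.Nonempty := by
      refine ⟨_, Finset.univ, ?_, rfl⟩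
      have hle : N.messageSpace c t ≤ N.errorSpace c t Finset.univ := by
        rintro _ ⟨X, rfl⟩
        rw [vecMul_decodingMatrix]
        exact Submodule.sum_mem _ fun a _ =>
          Submodule.smul_mem _ _ (row_mem_errorSpace c t (Finset.mem_univ a))
      rw [inf_eq_right.2 hle]
      omega
    obtain ⟨ρ₀, hpos, hrank⟩ := Nat.sInf_mem hne
    obtain ⟨ρ₁, hdom, hcard⟩ := exists_dominated_card_eq (N := N) F w t ρ₀
    -- A smallest pattern dominating `ρ₀` has rank equal to its size: by transitivity, anything
    -- dominating it also dominates `ρ₀`.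
    have hl : N.Linked t ρ₁ := by
      refine linked_of_patternRank_eq_card (F := F) (w := w)
        (le_antisymm (patternRank_le fun _ => le_rfl) ?_)
      obtain ⟨ρ₂, hdom', hcard'⟩ := exists_dominated_card_eq (N := N) F w t ρ₁
      rw [hcard, ← hcard']
      exact patternRank_le fun c => (hdom c).trans (hdom' c)
    obtain ⟨ρ, hρ₁ρ, hρ⟩ := hext ρ₁ hl (by omega)
    refine ⟨ρ, hρ, ?_⟩
    obtain ⟨⟨v, hvΔ, X, hX⟩, hv0⟩ := Module.finrank_pos_iff_exists_ne_zero.1 hpos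
    refine ⟨X, ?_, ?_⟩
    · rintro rfl
      refine hv0 (Subtype.ext ?_)
      simpa using hX
    · rw [← hX]
      exact errorSpace_mono c t hρ₁ρ (hdom c hvΔ)

/-- Union bound over the patterns in R_t(δ_t - d), each contributing the same estimate for
confusion. -/
theorem ncard_minDist_lt_mul_pow_le [Fintype V] [Fintype F] {t : V} (ht : t ∈ N.sinks)
    (hw : 1 ≤ w) (d : ℕ) :
    {c : N.Code w F | (N.minDist c t : ℤ) < N.redundancy w t + 1 - d}.ncard *
      (Fintype.card F - 1) ^ (d + 1) ≤ (N.patternsOfRank F w t (N.redundancy w t - d)).card *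
        (d + N.internalNodes.card + 1).choose N.internalNodes.card * Nat.card (N.Code w F) := by
  classical
  by_cases hd : d + w ≤ N.minCut t
  · obtain ⟨b, hb⟩ := Nat.exists_eq_add_of_le' hd
    have hred : N.redundancy w t - d = b := by unfold redundancy; omega
    have hsub : {c : N.Code w F | (N.minDist c t : ℤ) < N.redundancy w t + 1 - d} ⊆
        ⋃ ρ ∈ N.patternsOfRank F w t b, {c | Confusable c t ρ} := by
      intro c hc
      simp only [Set.mem_ofPred_eq] at hc
      obtain ⟨ρ, hρ, h⟩ := exists_confusable_of_minDist_le ht hw (by omega : b ≤ N.minCut t) c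
        (by omega)
      exact Set.mem_biUnion hρ h
    have hchoose : (d + N.internalNodes.card + 1).choose N.internalNodes.card =
        (N.internalNodes.card + 1).multichoose (d + 1) := by
      rw [Nat.multichoose_eq,
        show N.internalNodes.card + 1 + (d + 1) - 1 = N.internalNodes.card + (d + 1) by omega,
        show d + N.internalNodes.card + 1 = N.internalNodes.card + (d + 1) by omega]
      exact Nat.choose_symm_add
    rw [hred, hchoose]
    calc _ ≤ (∑ ρ ∈ N.patternsOfRank F w t b, {c : N.Code w F | Confusable c t ρ}.ncard) *
          (Fintype.card F - 1) ^ (d + 1) := Nat.mul_le_mul_right _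
          ((Set.ncard_le_ncard hsub (Set.toFinite _)).trans (Finset.set_ncard_biUnion_le _ _))
      _ ≤ ∑ ρ ∈ N.patternsOfRank F w t b,
          (N.internalNodes.card + 1).multichoose (d + 1) * Nat.card (N.Code w F) := by
          rw [Finset.sum_mul]
          refine Finset.sum_le_sum fun ρ hρ => ?_
          simp only [patternsOfRank, Finset.mem_filter, Finset.mem_univ, true_and,
            Nat.cast_inj] at hρ
          exact (linked_of_patternRank_eq_card (hρ.2.trans hρ.1.symm)).ncard_confusable_mul_pow_le
            ht (by omega)
      _ = _ := by rw [Finset.sum_const, smul_eq_mul, mul_assoc]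
  -- If d > δ_t, the threshold δ_t + 1 - d is at most 0 and no distance lies below it.
  · have hempty : {c : N.Code w F | (N.minDist c t : ℤ) < N.redundancy w t + 1 - d} = ∅ := by
      ext c
      simp only [Set.mem_ofPred_eq, Set.mem_empty_iff_false, iff_false, not_lt, redundancy]
      omega
    simp [hempty]

end RandomCodes

/-! ### From numbers of codes to probabilities -/

/-- A random code is uniformly distributed on the set of all codes. -/
theorem IsRandomCode.measureReal_mem [Fintype E] {Ω F : Type*} [MeasurableSpace Ω] {μ : Measure Ω}
    [IsProbabilityMeasure μ] [Fintype F] [MeasurableSpace F] [MeasurableSingletonClass F] {w : ℕ}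
    {K : Ω → N.Code w F} (hK : N.IsRandomCode μ K) (A : Set (N.Code w F)) :
    MeasurableSet {ω | K ω ∈ A} ∧
      μ.real {ω | K ω ∈ A} = A.ncard / (Nat.card (N.Code w F) : ℝ) := by
  classical
  have hfib : ∀ c : N.Code w F, {ω | K ω = c} = ⋂ p ∈ (Finset.univ : Finset (N.Pair w)),
      (fun ω => K ω p) ⁻¹' {c p} := by
    intro c; ext ω; simp [funext_iff]
  have hmeas : ∀ c : N.Code w F, MeasurableSet {ω | K ω = c} := by
    intro c
    rw [hfib]
    exact Finset.measurableSet_biInter _ fun p _ => hK.measurable p (measurableSet_singleton _)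
  have hunif : ∀ c : N.Code w F, μ.real {ω | K ω = c} = 1 / (Nat.card (N.Code w F) : ℝ) := by
    intro c
    have h := hK.indep.measure_inter_preimage_eq_mul Finset.univ (sets := fun p => {c p})
      fun p _ => measurableSet_singleton _
    rw [hfib, measureReal_def, h, ENNReal.toReal_prod]
    have h1 : ∀ p, (μ ((fun ω => K ω p) ⁻¹' {c p})).toReal = 1 / (Fintype.card F : ℝ) :=
      fun p => hK.uniform p (c p)
    rw [Finset.prod_congr rfl fun p _ => h1 p]
    simp [Nat.card_eq_fintype_card]
  have hun : {ω | K ω ∈ A} = ⋃ c ∈ A.toFinset, {ω | K ω = c} := by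
    ext ω; simp
  constructor
  · rw [hun]
    exact Finset.measurableSet_biUnion _ fun c _ => hmeas c
  · rw [hun, measureReal_biUnion_finset (f := fun c => {ω | K ω = c}) (fun c _ c' _ hcc' => Set.disjoint_left.2
      fun ω (h : K ω = c) (h' : K ω = c') => hcc' (h.symm.trans h')) fun c _ => hmeas c,
      Finset.sum_congr rfl fun c _ => hunif c, Finset.sum_const, nsmul_eq_mul,
      Set.ncard_eq_toFinset_card', mul_one_div]

theorem card_patternsOfRank_le [Fintype E] (F : Type*) [Field F] (N : Network V E) (w : ℕ) (t : V)
    (b : ℤ) : (N.patternsOfRank F w t b).card ≤ (Fintype.card E).choose b.toNat := by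
  classical
  rw [← Finset.card_univ, ← Finset.card_powersetCard]
  refine Finset.card_le_card fun ρ hρ => ?_
  simp only [patternsOfRank, Finset.mem_filter, Finset.mem_univ, true_and] at hρ
  simp only [Finset.mem_powersetCard, Finset.subset_univ, true_and]
  omega

theorem IsRandomCode.measureReal_minDist_lt_le [Fintype V] [Fintype E] {Ω F : Type*}
    [MeasurableSpace Ω] {μ : Measure Ω} [IsProbabilityMeasure μ] [Field F] [Fintype F]
    [MeasurableSpace F] [MeasurableSingletonClass F] {w : ℕ} (hw : 1 ≤ w)
    {K : Ω → N.Code w F} (hK : N.IsRandomCode μ K) {t : V} (ht : t ∈ N.sinks) (d : ℕ) :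
    μ.real {ω | (N.minDist (K ω) t : ℤ) < N.redundancy w t + 1 - d} ≤
      ((N.patternsOfRank F w t (N.redundancy w t - d)).card : ℝ) *
          ((d + N.internalNodes.card + 1).choose N.internalNodes.card : ℝ) /
        ((Fintype.card F : ℝ) - 1) ^ (d + 1) := by
  have h := (hK.measureReal_mem
    {c : N.Code w F | (N.minDist c t : ℤ) < N.redundancy w t + 1 - d}).2
  simp only [Set.mem_ofPred_eq] at h
  rw [h]
  have hq : 1 < Fintype.card F := Fintype.one_lt_card
  have hq' : (0 : ℝ) < (Fintype.card F : ℝ) - 1 := by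
    rw [sub_pos]; exact_mod_cast hq
  have hcard : (0 : ℝ) < Nat.card (N.Code w F) := by exact_mod_cast Nat.card_pos
  rw [div_le_div_iff₀ hcard (pow_pos hq' _)]
  have hle := ncard_minDist_lt_mul_pow_le (F := F) ht hw d
  have hle' : (_ : ℝ) ≤ _ := Nat.cast_le.2 hle
  push_cast [Nat.cast_sub hq.le] at hle'
  exact hle'

end Network

end NEC

theorem mainTheorem9 {V E F Ω : Type*} [Fintype V] [Fintype E] [Field F] [Fintype F]
    [MeasurableSpace F] [MeasurableSingletonClass F] [MeasurableSpace Ω]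
    (μ : Measure Ω) [IsProbabilityMeasure μ]
    (N : NEC.Network V E) (w : ℕ) (hw : 1 ≤ w) (hwC : ∀ t ∈ N.sinks, w ≤ N.minCut t)
    (K : Ω → N.Code w F) (hK : N.IsRandomCode μ K) (d : ℕ) :
    (∀ t ∈ N.sinks,
      μ.real {ω | (N.minDist (K ω) t : ℤ) < N.redundancy w t + 1 - d} ≤
        ((N.patternsOfRank F w t (N.redundancy w t - d)).card : ℝ) *
            ((d + N.internalNodes.card + 1).choose N.internalNodes.card : ℝ) /
          ((Fintype.card F : ℝ) - 1) ^ (d + 1)) ∧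
    (μ.real {ω | ∀ t ∈ N.sinks, N.redundancy w t + 1 - d ≤ (N.minDist (K ω) t : ℤ)} ≥
      1 - ∑ t ∈ N.sinks,
        ((N.patternsOfRank F w t (N.redundancy w t - d)).card : ℝ) *
            ((d + N.internalNodes.card + 1).choose N.internalNodes.card : ℝ) /
          ((Fintype.card F : ℝ) - 1) ^ (d + 1)) ∧
    (∀ t ∈ N.sinks, (d : ℤ) ≤ N.redundancy w t →
      (N.patternsOfRank F w t (N.redundancy w t - d)).card ≤
        (Fintype.card E).choose (N.redundancy w t - d).toNat) := by
  refine ⟨fun t ht => hK.measureReal_minDist_lt_le hw ht d, ?_,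
    fun t _ _ => NEC.Network.card_patternsOfRank_le F N w t _⟩
  have hmeas := (hK.measureReal_mem
    {c | ∀ t ∈ N.sinks, N.redundancy w t + 1 - d ≤ (N.minDist c t : ℤ)}).1
  simp only [Set.mem_ofPred_eq] at hmeas
  have hcompl := probReal_compl_eq_one_sub (μ := μ) hmeas
  -- Union bound over the sinks: the complementary event means that the distance is too small at
  -- some sink.
  have hsub : {ω | ∀ t ∈ N.sinks, N.redundancy w t + 1 - d ≤ (N.minDist (K ω) t : ℤ)}ᶜ ⊆
      ⋃ t ∈ N.sinks, {ω | (N.minDist (K ω) t : ℤ) < N.redundancy w t + 1 - d} := by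
    intro ω hω
    simp only [Set.mem_compl_iff, Set.mem_ofPred_eq, not_forall, not_le] at hω
    obtain ⟨t, ht, h⟩ := hω
    exact Set.mem_biUnion ht h
  have hle := (measureReal_mono hsub (measure_ne_top μ _)).trans
    ((measureReal_biUnion_finset_le _ _).trans
      (Finset.sum_le_sum fun t ht => hK.measureReal_minDist_lt_le hw ht d))
  linarith
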